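/- **Setting.** Let $d\in\mathbb N$. A quantum state is a Hermitian positive semidefinite $d\times d$ complex matrix of trace one; it is full rank if all its eigenvalues are positive. A POVM with finite outcome set $\mathcal X$ is a family $m=(m(x))_{x\in\mathcal X}$ of positive semidefinite matrices with $\sum_x m(x)=\mathbb I$; on a state $\rho$ it induces the distribution $P_{\rho,m}(x)=\mathrm{Tr}[m(x)\rho]$ on $\mathcal X$. The measured relative entropy is $$D_{\mathcal M}(\rho\|\sigma):=\sup_{\mathcal X}\sup_{m}D(P_{\rho,m}\|P_{\sigma,m}),$$ the supremum being over all finite outcome sets $\mathcal X$ and all POVMs $m$ with outcomes in $\mathcal X$, and $D$ being the Kullback–Leibler divergence with natural logarithm. A sequential quantum hypothesis test $\mathcal S=(\mathcal X,\{\mu_k,d_k\}_{k\ge1})$ consists of a finite outcome set $\mathcal X$, conditional probability measures (Markov kernels) $\mu_k(\cdot\mid x_1^{k-1},m_1^{k-1})$ on the POVMs with outcome set $\mathcal X$, and measurable decision rules $d_k(x_1^k,m_1^k)\in\{0,1,*\}$. In round $k$ a fresh copy of the unknown state $\rho^\star$ is taken, a POVM $M_k$ is drawn from $\mu_k$ given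 the past, and the outcome $X_k=x$ is observed with probability $\mathrm{Tr}[M_k(x)\rho^\star]$. Let $\mathbb P_{\mathcal S,\rho^\star}$ be the resulting law of $(M_k,X_k)_{k\ge1}$, and let $T:=\inf\{k\ge1:d_k\in\{0,1\}\}$ (with $\inf\emptyset=\infty$) be the stopping time. Fix a state $\rho$ and a set $\mathcal D$ of states. For a sequence of tests $(\mathcal S_n)_{n}$ with stopping times $T_n$, write $\mathbb P_{n,\rho}=\mathbb P_{\mathcal S_n,\rho}$, let $\mathbb E_{n,\rho}$ be the corresponding expectation, and put $$\alpha_n^\star:=\mathbb P_{n,\rho}(T_n<\infty,\ d_{T_n}=1),\qquad \beta_n^\star:=\sup_{\sigma\in\mathcal D}\mathbb P_{n,\sigma}(T_n<\infty,\ d_{T_n}=0).$$ A pair $(R_0,R_1)$ of nonnegative reals is achievable if there is a sequence of tests with $\alpha_n^\star\to0$, $\beta_n^\star\to0$, $$\liminf_{n\to\infty}\tfrac1n\log\tfrac1{\alpha_n^\star}\ge R_0,\qquad \liminf_{n\to\infty}\tfrac1n\log\tfrac1{\beta_n^\star}\ge R_1,$$ $$\limsup_{n\to\infty}\Bigl(\max\bigl\{\mathbb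 E_{n,\rho}[T_n],\ \sup_{\sigma\in\mathcal D}\mathbb E_{n,\sigma}[T_n]\bigr\}-n\Bigr)\le0 .$$ The error exponent region $\mathcal A(\{\rho\},\mathcal D)\subseteq\mathbb R^2$ is the closure of the set of achievable pairs. **Theorem.** Let $\rho$ be a full-rank state, and let $\mathcal D$ be a compact, convex set of full-rank states with nonempty interior relative to the affine space of Hermitian $d\times d$ matrices of trace one, such that $\rho\notin\mathcal D$. Then $$\mathcal A(\{\rho\},\mathcal D)=\Bigl\{(R_0,R_1):\ 0\le R_0\le \inf_{\sigma\in\mathcal D}D_{\mathcal M}(\sigma\|\rho),\ \ 0\le R_1\le\inf_{\sigma\in\mathcal D}D_{\mathcal M}(\rho\|\sigma)\Bigr\}.$$ This holds both when the outcome set, the measurement strategy and the decision rules of $\mathcal S_n$ may all vary with $n$, and when, in the definition of achievability, the outcome set $\mathcal X$ and the strategy $\{\mu_k\}_k$ are required to be the same for all $n$ and only the decision rules $d_{n,k}$ vary. -/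

import Mathlib

open MeasureTheory ProbabilityTheory Filter Topology
open scoped ENNReal ComplexOrder

namespace SQHT

/-! ### States and measurements -/

/-- The affine space of Hermitian `d × d` matrices of unit trace. -/
def traceOneHermitian (d : ℕ) : Set (Matrix (Fin d) (Fin d) ℂ) :=
  {a | a.IsHermitian ∧ a.trace = 1}

/-- The set of quantum states (density matrices) on `ℂ^d`. -/
def stateSpace (d : ℕ) : Set (Matrix (Fin d) (Fin d) ℂ) :=
  {a | a.PosSemidef ∧ a.trace = 1}

/-- The set of full-rank quantum states: those whose eigenvalues are all positive. -/
def fullRankStates (d : ℕ) : Set (Matrix (Fin d) (Fin d) ℂ) :=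
  {a | a.PosDef ∧ a.trace = 1}

/-- POVMs on `ℂ^d` with outcome set `{0, …, m - 1}`. Any finite outcome set is of this form up to
relabelling. -/
def POVM (d m : ℕ) : Type :=
  {M : Fin m → Matrix (Fin d) (Fin d) ℂ // (∀ x, (M x).PosSemidef) ∧ ∑ x, M x = 1}

noncomputable instance (d m : ℕ) : TopologicalSpace (POVM d m) := instTopologicalSpaceSubtype

noncomputable instance (d m : ℕ) : MeasurableSpace (POVM d m) := borel _

instance (d m : ℕ) : BorelSpace (POVM d m) := ⟨rfl⟩

/-- Born's rule: the probability `tr[M(x) ρ]` of the outcome `x`. -/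
noncomputable def bornProb {d m : ℕ} (ρ : stateSpace d) (M : POVM d m) (x : Fin m) : ℝ :=
  (M.1 x * ρ.1).trace.re

/-- The outcome distribution `P_{ρ,M}` on the outcome set. -/
noncomputable def bornMeasure {d m : ℕ} (ρ : stateSpace d) (M : POVM d m) : Measure (Fin m) :=
  ∑ x, ENNReal.ofReal (bornProb ρ M x) • Measure.dirac x

section

open scoped MatrixOrder

theorem bornProb_nonneg {d m : ℕ} (ρ : stateSpace d) (M : POVM d m) (x : Fin m) :
    0 ≤ bornProb ρ M x := by
  obtain ⟨C, hC⟩ := CStarAlgebra.nonneg_iff_eq_star_mul_self.mp (M.2.1 x).nonneg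
  have h := (ρ.2.1.mul_mul_conjTranspose_same C).trace_nonneg
  have e : (M.1 x * ρ.1).trace = (C * ρ.1 * C.conjTranspose).trace := by
    rw [hC, Matrix.star_eq_conjTranspose, Matrix.mul_assoc, Matrix.trace_mul_comm]
  unfold bornProb
  rw [e]
  exact (Complex.le_def.1 h).1

end

theorem sum_bornProb {d m : ℕ} (ρ : stateSpace d) (M : POVM d m) :
    ∑ x, bornProb ρ M x = 1 := by
  unfold bornProb
  rw [← Complex.re_sum, ← Matrix.trace_sum, ← Finset.sum_mul, M.2.2, Matrix.one_mul, ρ.2.2]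
  simp

instance {d m : ℕ} (ρ : stateSpace d) (M : POVM d m) : IsProbabilityMeasure (bornMeasure ρ M) := by
  constructor
  simp only [bornMeasure, Measure.coe_finsetSum, Finset.sum_apply, Measure.smul_apply,
    measure_univ, smul_eq_mul, mul_one]
  rw [← ENNReal.ofReal_sum_of_nonneg fun x _ => bornProb_nonneg ρ M x, sum_bornProb,
    ENNReal.ofReal_one]

theorem measurable_bornMeasure {d m : ℕ} (ρ : stateSpace d) :
    Measurable (bornMeasure ρ : POVM d m → Measure (Fin m)) := by
  refine Measure.measurable_of_measurable_coe _ fun s _ => ?_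
  simp only [bornMeasure, Measure.coe_finsetSum, Finset.sum_apply, Measure.smul_apply,
    smul_eq_mul]
  refine Finset.measurable_sum _ fun x _ => Measurable.mul_const ?_ _
  refine ENNReal.measurable_ofReal.comp (Continuous.measurable ?_)
  have h : Continuous fun M : POVM d m => M.1 x := (continuous_apply x).comp continuous_subtype_val
  exact Complex.continuous_re.comp (h.matrix_mul continuous_const).matrix_trace

/-- The kernel sending a POVM `M` to the law `P_{ρ,M}` of its outcome on the state `ρ`. -/
noncomputable def bornKernel {d : ℕ} (m : ℕ) (ρ : stateSpace d) : Kernel (POVM d m) (Fin m) where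
  toFun := bornMeasure ρ
  measurable' := measurable_bornMeasure ρ

instance {d m : ℕ} (ρ : stateSpace d) : IsMarkovKernel (bornKernel m ρ) :=
  ⟨fun M => inferInstanceAs (IsProbabilityMeasure (bornMeasure ρ M))⟩

/-- The measured relative entropy `D_M(ρ‖σ)`: the supremum, over all finite outcome sets and all
POVMs, of the Kullback-Leibler divergence of the outcome distributions (natural logarithm). -/
noncomputable def measuredRelEntropy {d : ℕ} (ρ σ : stateSpace d) : ℝ≥0∞ :=
  ⨆ (m : ℕ) (M : POVM d m), InformationTheory.klDiv (bornMeasure ρ M) (bornMeasure σ M)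

/-! ### Adaptive sequential tests -/

/-- One round: the POVM that was applied and the outcome that was observed. Rounds are numbered
from `0`, so round `k` consumes the `(k + 1)`-st copy. -/
abbrev Round (d m : ℕ) : Type := POVM d m × Fin m

/-- What has been seen in rounds `0, …, k`. -/
abbrev History (d m k : ℕ) : Type := Finset.Iic k → Round d m

/-- A (randomized) adaptive measurement strategy: the law of the first POVM, and the conditional
law of the POVM of round `k + 1` given the POVMs and outcomes of rounds `0, …, k`. -/
structure Strategy (d m : ℕ) where
  first : Measure (POVM d m)
  next : (k : ℕ) → Kernel (History d m k) (POVM d m)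
  isProbabilityMeasure_first : IsProbabilityMeasure first
  isMarkovKernel_next : ∀ k, IsMarkovKernel (next k)

attribute [instance] Strategy.isProbabilityMeasure_first Strategy.isMarkovKernel_next

/-- The possible verdicts after a round: stop and declare the null hypothesis, stop and declare
the alternative, or continue. -/
inductive Verdict : Type
  | null
  | alt
  | continue

/-- A decision rule: after each round, a measurable function of the history to the verdicts. -/
structure DecisionRule (d m : ℕ) where
  decide : (k : ℕ) → History d m k → Verdict
  measurableSet_decide : ∀ (k : ℕ) (v : Verdict), MeasurableSet (decide k ⁻¹' {v})

/-- A sequential quantum hypothesis test: a finite outcome set, an adaptive measurement strategy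
and a decision rule. -/
structure Test (d : ℕ) where
  numOutcomes : ℕ
  strategy : Strategy d numOutcomes
  decision : DecisionRule d numOutcomes

/-- The law of the infinite sequence of POVMs and outcomes when every copy is in the state `ρ`:
in each round the POVM is drawn from the strategy given the past, and then the outcome is drawn
from Born's rule. -/
noncomputable def Strategy.law {d m : ℕ} (μ : Strategy d m) (ρ : stateSpace d) :
    Measure (ℕ → Round d m) :=
  Kernel.trajMeasure (X := fun _ => Round d m) (μ.first ⊗ₘ bornKernel m ρ)
    (fun k => μ.next k ⊗ₖ Kernel.prodMkLeft (History d m k) (bornKernel m ρ))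

/-- The verdict after round `k` along the sequence `ω`. -/
def DecisionRule.verdict {d m : ℕ} (δ : DecisionRule d m) (ω : ℕ → Round d m) (k : ℕ) : Verdict :=
  δ.decide k (fun i => ω i)

/-- The stopping time `T`, that is the number of copies used: `T = k + 1` if `k` is the first round
whose verdict is not to continue, and `T = ∞` if there is none. -/
noncomputable def DecisionRule.stoppingTime {d m : ℕ} (δ : DecisionRule d m)
    (ω : ℕ → Round d m) : ℕ∞ :=
  ⨅ (k : ℕ) (_ : δ.verdict ω k ≠ Verdict.continue), ((k + 1 : ℕ) : ℕ∞)

/-- The event that the test stops (at a finite time) with the verdict `v`. -/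
def DecisionRule.declares {d m : ℕ} (δ : DecisionRule d m) (v : Verdict) :
    Set (ℕ → Round d m) :=
  {ω | ∃ k : ℕ, δ.stoppingTime ω = ((k + 1 : ℕ) : ℕ∞) ∧ δ.verdict ω k = v}

/-- The expected number of copies used when the state is `ρ`. -/
noncomputable def Test.expectedTime {d : ℕ} (S : Test d) (ρ : stateSpace d) : ℝ≥0∞ :=
  ∫⁻ ω, (S.decision.stoppingTime ω : ℝ≥0∞) ∂(S.strategy.law ρ)

/-- The Type-I error: the alternative is declared although the state is `ρ`. -/
noncomputable def Test.typeIError {d : ℕ} (S : Test d) (ρ : stateSpace d) : ℝ≥0∞ :=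
  S.strategy.law ρ (S.decision.declares Verdict.alt)

/-- The worst-case Type-II error: the null is declared although the state lies in `D`. -/
noncomputable def Test.typeIIError {d : ℕ} (S : Test d) (D : Set (Matrix (Fin d) (Fin d) ℂ)) :
    ℝ≥0∞ :=
  ⨆ (σ : stateSpace d) (_ : σ.1 ∈ D), S.strategy.law σ (S.decision.declares Verdict.null)

/-- The worst-case expected number of copies over both hypotheses. -/
noncomputable def Test.worstExpectedTime {d : ℕ} (S : Test d) (ρ : stateSpace d)
    (D : Set (Matrix (Fin d) (Fin d) ℂ)) : ℝ≥0∞ :=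
  max (S.expectedTime ρ) (⨆ (σ : stateSpace d) (_ : σ.1 ∈ D), S.expectedTime σ)

/-! ### Error exponents -/

/-- The sequence of tests `S` achieves the exponents `R = (R₀, R₁)` under the expectation
constraint: both errors vanish, they decay with exponents at least `R₀` and `R₁`, and the expected
number of copies exceeds `n` by an asymptotically negligible amount at most. -/
def Achieves {d : ℕ} (ρ : stateSpace d) (D : Set (Matrix (Fin d) (Fin d) ℂ)) (S : ℕ → Test d)
    (R : ℝ × ℝ) : Prop :=
  Tendsto (fun n => (S n).typeIError ρ) atTop (𝓝 0) ∧
  Tendsto (fun n => (S n).typeIIError D) atTop (𝓝 0) ∧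
  (R.1 : EReal) ≤
    liminf (fun n : ℕ => ((1 / n : ℝ) : EReal) * ENNReal.log ((S n).typeIError ρ)⁻¹) atTop ∧
  (R.2 : EReal) ≤
    liminf (fun n : ℕ => ((1 / n : ℝ) : EReal) * ENNReal.log ((S n).typeIIError D)⁻¹) atTop ∧
  limsup (fun n : ℕ => ((S n).worstExpectedTime ρ D : EReal) - ((n : ℝ) : EReal)) atTop ≤ 0

/-- The error exponent region: the closure of the set of pairs of nonnegative exponents achieved
by some sequence of tests. The outcome set, the strategy and the decision rule may all depend
on `n`. -/
def errorExponentRegion {d : ℕ} (ρ : stateSpace d) (D : Set (Matrix (Fin d) (Fin d) ℂ)) :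
    Set (ℝ × ℝ) :=
  closure {R | 0 ≤ R.1 ∧ 0 ≤ R.2 ∧ ∃ S : ℕ → Test d, Achieves ρ D S R}

/-- The same region for sequences of tests `(𝒳, {μ_k, d_{n,k}}_k)` in which only the decision rule
depends on `n`, the outcome set and the measurement strategy being common to all `n`. -/
def commonStrategyRegion {d : ℕ} (ρ : stateSpace d) (D : Set (Matrix (Fin d) (Fin d) ℂ)) :
    Set (ℝ × ℝ) :=
  closure {R | 0 ≤ R.1 ∧ 0 ≤ R.2 ∧ ∃ (m : ℕ) (μ : Strategy d m) (δ : ℕ → DecisionRule d m),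
    Achieves ρ D (fun n => ⟨m, μ, δ n⟩) R}

/-- The rectangle of pairs `0 ≤ R₀ ≤ inf_{σ ∈ D} D_M(σ‖ρ)`, `0 ≤ R₁ ≤ inf_{σ ∈ D} D_M(ρ‖σ)`. -/
def entropyRectangle {d : ℕ} (ρ : stateSpace d) (D : Set (Matrix (Fin d) (Fin d) ℂ)) :
    Set (ℝ × ℝ) :=
  {R | 0 ≤ R.1 ∧ 0 ≤ R.2 ∧
    (R.1 : EReal) ≤ ((⨅ (σ : stateSpace d) (_ : σ.1 ∈ D), measuredRelEntropy σ ρ : ℝ≥0∞) : EReal) ∧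
    (R.2 : EReal) ≤ ((⨅ (σ : stateSpace d) (_ : σ.1 ∈ D), measuredRelEntropy ρ σ : ℝ≥0∞) : EReal)}

end SQHT

/-! The rectangle lies in `commonStrategyRegion`, which trivially lies in `errorExponentRegion`, so
it remains to bound the larger region from above and to achieve the rectangle with one strategy for
all `n`.

Converse. Let `Z` be the log-likelihood ratio of ρ against σ, stopped at the stopping time `T`.
However adaptive the strategy is, the conditional mean under ρ of one increment is the divergence of
an outcome distribution, so E_ρ Z ≤ D_M(ρ‖σ) E_ρ T by Wald's argument. Change of measure at `T`
gives E_ρ exp(a 1_A − Z) ≤ 1 + e^a P_σ(A), where `A` is the event of a given verdict, and 1 + x ≤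
e^x turns this into a P_ρ(A) ≤ D_M(ρ‖σ) E_ρ T + e^a P_σ(A) (`mul_law_declares_le`). With `A` the
verdict that is correct under ρ and `a` slightly below `n` times the exponent of P_σ(A), the
exponent is at most D_M(ρ‖σ). Exchanging ρ and σ bounds the other exponent.

Achievability. Statistics of measurements are closed under mixing, provided the outcome records
which measurement was applied. A finite-dimensional separation argument
(`exists_forall_lt_of_forall_exists_lt`) therefore exchanges quantifiers: one measurement with a
statistic f₁ has mean above r₁ under ρ and satisfies E_σ exp(f₁) ≤ 1 for all σ in `D` at once;
likewise some f₀ has mean above r₀ on all of `D` and E_ρ exp(f₀) ≤ 1. The test measures for f₁ while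
its running sum is at least that of f₀, and for f₀ otherwise; it stops when the first sum reaches n
R₁ or the second reaches n R₀, where R₁ < r₁ and R₀ < r₀. Ville's inequality bounds the errors by
exp(−n R₀) and exp(−n R₁). By Jensen, each statistic has negative mean under the hypothesis it tests
against, so the difference of the sums drifts towards the truth whichever measurement is used
(`exists_favours`). The expected number of rounds with the wrong measurement is thus bounded, and E
T is at most n R₁ / r₁ or n R₀ / r₀ up to a constant, hence eventually below `n`. -/

namespace SQHT

/-! ### Disintegration of the law of the rounds, and change of measure -/

variable {d m m' : ℕ}

/-- The first `k` rounds of a sequence of rounds. -/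
def past (k : ℕ) (ω : ℕ → Round d m) : Fin k → Round d m := fun i => ω i

@[fun_prop]
theorem measurable_past (k : ℕ) : Measurable (past k : (ℕ → Round d m) → Fin k → Round d m) :=
  measurable_pi_lambda _ fun i => measurable_pi_apply (i : ℕ)

/-- A function of `k + 1` rounds, as a history. -/
def toHistory (k : ℕ) (p : Fin (k + 1) → Round d m) : History d m k :=
  fun i => p ⟨i, Nat.lt_succ_of_le (Finset.mem_Iic.1 i.2)⟩

/-- A history as a function of `k + 1` rounds. -/
def ofHistory (k : ℕ) (h : History d m k) : Fin (k + 1) → Round d m :=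
  fun i => h ⟨i, Finset.mem_Iic.2 (Nat.le_of_lt_succ i.2)⟩

@[fun_prop]
theorem measurable_toHistory (k : ℕ) :
    Measurable (toHistory k : (Fin (k + 1) → Round d m) → History d m k) :=
  measurable_pi_lambda _ fun _ => measurable_pi_apply _

@[fun_prop]
theorem measurable_ofHistory (k : ℕ) :
    Measurable (ofHistory k : History d m k → Fin (k + 1) → Round d m) :=
  measurable_pi_lambda _ fun _ => measurable_pi_apply _

/-- The conditional law of the POVM of round `k` given the first `k` rounds. -/
noncomputable def Strategy.choice (μ : Strategy d m) :
    (k : ℕ) → Kernel (Fin k → Round d m) (POVM d m)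
  | 0 => Kernel.const _ μ.first
  | k + 1 => (μ.next k).comap (toHistory k) (measurable_toHistory k)

instance (μ : Strategy d m) (k : ℕ) : IsMarkovKernel (μ.choice k) := by
  cases k <;> unfold Strategy.choice <;> infer_instance

instance (μ : Strategy d m) (ρ : stateSpace d) : IsProbabilityMeasure (μ.law ρ) := by
  unfold Strategy.law; infer_instance

theorem lintegral_bornMeasure (ρ : stateSpace d) (M : POVM d m) (f : Fin m → ℝ≥0∞) :
    ∫⁻ x, f x ∂(bornMeasure ρ M) = ∑ x, ENNReal.ofReal (bornProb ρ M x) * f x := by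
  simp [bornMeasure, lintegral_smul_measure]

theorem integral_bornMeasure (ρ : stateSpace d) (M : POVM d m) (f : Fin m → ℝ) :
    ∫ x, f x ∂(bornMeasure ρ M) = ∑ x, bornProb ρ M x * f x := by
  unfold bornMeasure
  rw [integral_finsetSum_measure fun x _ =>
    (integrable_dirac (by finiteness)).smul_measure ENNReal.ofReal_ne_top]
  refine Finset.sum_congr rfl fun x _ => ?_
  rw [integral_smul_measure, integral_dirac, ENNReal.toReal_ofReal (bornProb_nonneg ρ M x),
    smul_eq_mul]

theorem map_eval_zero_law (μ : Strategy d m) (ρ : stateSpace d) :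
    (μ.law ρ).map (fun ω => ω 0) = μ.first ⊗ₘ bornKernel m ρ := by
  have h : (fun ω : ℕ → Round d m => ω 0) =
      (MeasurableEquiv.piUnique (fun _ : Finset.Iic 0 => Round d m)) ∘
        (Preorder.frestrictLe 0) := by
    ext ω <;> rfl
  rw [h, ← Measure.map_map (by fun_prop) (by fun_prop), Strategy.law, Kernel.trajMeasure,
    Measure.map_comp _ _ (by fun_prop), Kernel.traj_map_frestrictLe, Kernel.partialTraj_self,
    Measure.id_comp, Measure.map_map (by fun_prop) (by fun_prop)]
  exact Measure.map_id

/-- Disintegration of the law of the rounds at round `k`. -/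
theorem lintegral_law (μ : Strategy d m) (ρ : stateSpace d) (k : ℕ)
    (F : (Fin k → Round d m) → Round d m → ℝ≥0∞) (hF : Measurable (Function.uncurry F)) :
    ∫⁻ ω, F (past k ω) (ω k) ∂(μ.law ρ) =
      ∫⁻ ω, ∫⁻ M, ∑ x, ENNReal.ofReal (bornProb ρ M x) * F (past k ω) (M, x)
        ∂(μ.choice k (past k ω)) ∂(μ.law ρ) := by
  have hF' : ∀ p, Measurable (F p) := fun p => hF.comp measurable_prodMk_left
  cases k with
  | zero =>
    have hp : ∀ ω : ℕ → Round d m, past 0 ω = Fin.elim0 := fun ω => Subsingleton.elim _ _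
    simp only [hp, Strategy.choice, Kernel.const_apply, lintegral_const, measure_univ, mul_one]
    refine (lintegral_map (g := fun ω : ℕ → Round d m => ω 0) (hF' _)
      (measurable_pi_apply 0)).symm.trans ?_
    rw [map_eval_zero_law, Measure.lintegral_compProd (hF' _)]
    exact lintegral_congr fun M => lintegral_bornMeasure ρ M _
  | succ k =>
    have hp : ∀ ω : ℕ → Round d m, past (k + 1) ω = ofHistory k (Preorder.frestrictLe k ω) :=
      fun ω => rfl
    have hq : ∀ h : History d m k, toHistory k (ofHistory k h) = h := fun h => rfl
    have hG : Measurable (fun q : History d m k × Round d m => F (ofHistory k q.1) q.2) :=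
      hF.comp (by fun_prop : Measurable fun q : History d m k × Round d m =>
        (ofHistory k q.1, q.2))
    have key := Kernel.map_frestrictLe_trajMeasure_compProd_eq_map_trajMeasure
      (X := fun _ => Round d m) (μ₀ := μ.first ⊗ₘ bornKernel m ρ)
      (κ := fun k => μ.next k ⊗ₖ Kernel.prodMkLeft (History d m k) (bornKernel m ρ)) (a := k)
    change (μ.law ρ).map _ ⊗ₘ _ = (μ.law ρ).map _ at key
    simp only [hp]
    refine (lintegral_map (g := fun ω : ℕ → Round d m => (Preorder.frestrictLe k ω, ω (k + 1))) hG
      (by fun_prop)).symm.trans ?_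
    rw [← key, Measure.lintegral_compProd hG, lintegral_map (by fun_prop) (by fun_prop)]
    refine lintegral_congr fun ω => ?_
    refine (Kernel.lintegral_compProd (μ.next k)
      (Kernel.prodMkLeft (History d m k) (bornKernel m ρ)) (Preorder.frestrictLe k ω)
      (hF' (ofHistory k (Preorder.frestrictLe k ω)))).trans ?_
    simp only [Strategy.choice, Kernel.comap_apply, hq]
    exact lintegral_congr fun M => lintegral_bornMeasure ρ M _

@[fun_prop]
theorem measurable_bornProb (ρ : stateSpace d) (x : Fin m) :
    Measurable fun M : POVM d m => bornProb ρ M x := by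
  have h : Continuous fun M : POVM d m => M.1 x := (continuous_apply x).comp continuous_subtype_val
  exact (Complex.continuous_re.comp
    (h.matrix_mul continuous_const).matrix_trace).measurable

theorem sum_ofReal_bornProb (ρ : stateSpace d) (M : POVM d m) :
    ∑ x, ENNReal.ofReal (bornProb ρ M x) = 1 := by
  rw [← ENNReal.ofReal_sum_of_nonneg fun x _ => bornProb_nonneg ρ M x, sum_bornProb,
    ENNReal.ofReal_one]

/-- Born's rule: the outcome of round `k` may be averaged given the past and the POVM used. -/
theorem lintegral_past_mul (μ : Strategy d m) (ρ : stateSpace d) (k : ℕ)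
    {F : (Fin k → Round d m) → ℝ≥0∞} (hF : Measurable F) {w : Round d m → ℝ≥0∞}
    (hw : Measurable w) :
    ∫⁻ ω, F (past k ω) * w (ω k) ∂(μ.law ρ) =
      ∫⁻ ω, F (past k ω) * ∑ x, ENNReal.ofReal (bornProb ρ (ω k).1 x) * w ((ω k).1, x)
        ∂(μ.law ρ) := by
  have hs : Measurable fun r : Round d m =>
      ∑ x, ENNReal.ofReal (bornProb ρ r.1 x) * w (r.1, x) := by fun_prop
  rw [lintegral_law μ ρ k (fun p r => F p * w r) (by fun_prop),
    lintegral_law μ ρ k (fun p r => F p * ∑ x, ENNReal.ofReal (bornProb ρ r.1 x) * w (r.1, x))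
      ((hF.comp measurable_fst).mul (hs.comp measurable_snd))]
  refine lintegral_congr fun ω => lintegral_congr fun M => ?_
  simp only
  rw [← Finset.sum_mul, sum_ofReal_bornProb, one_mul, Finset.mul_sum]
  exact Finset.sum_congr rfl fun x _ => by ring

/-- The σ-algebra of the events that are determined by the first `k` rounds. -/
noncomputable abbrev pastAlgebra (d m k : ℕ) : MeasurableSpace (ℕ → Round d m) :=
  MeasurableSpace.comap (past k) inferInstance

theorem pastAlgebra_le (k : ℕ) : pastAlgebra d m k ≤ MeasurableSpace.pi :=
  (measurable_past k).comap_le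

theorem measurable_pastAlgebra_eval {i k : ℕ} (h : i < k) :
    Measurable[pastAlgebra d m k] fun ω : ℕ → Round d m => ω i := by
  have : (fun ω : ℕ → Round d m => ω i) = (fun p : Fin k → Round d m => p ⟨i, h⟩) ∘ past k := rfl
  rw [this]
  exact (measurable_pi_apply _).comp (comap_measurable _)

/-- The conditional mean of the outcome statistic of round `k`, in the form needed for Wald-type
identities: the event that round `k` is reached belongs to `pastAlgebra d m k`. -/
theorem setIntegral_born (μ : Strategy d m) (ρ : stateSpace d) {k : ℕ}
    {A : Set (ℕ → Round d m)} (hA : MeasurableSet[pastAlgebra d m k] A) {φ : Round d m → ℝ}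
    (hφ : Measurable φ) {C : ℝ} (hC : ∀ r, |φ r| ≤ C) :
    ∫ ω in A, φ (ω k) ∂(μ.law ρ) =
      ∫ ω in A, ∑ x, bornProb ρ (ω k).1 x * φ ((ω k).1, x) ∂(μ.law ρ) := by
  obtain ⟨B, hB, rfl⟩ := hA
  set ν := (μ.law ρ).restrict (past k ⁻¹' B)
  -- Restricting to an event of the past does not disturb Born's rule for round `k`.
  have key : ν.map (fun ω => ω k) = ν.map (fun ω => (ω k).1) ⊗ₘ bornKernel m ρ := by
    refine Measure.ext_of_lintegral _ fun w hw => ?_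
    have hI : Measurable (B.indicator (1 : (Fin k → Round d m) → ℝ≥0∞)) :=
      measurable_one.indicator hB
    have h := lintegral_past_mul μ ρ k hI hw
    have e : ∀ v : (ℕ → Round d m) → ℝ≥0∞,
        ∫⁻ ω, B.indicator 1 (past k ω) * v ω ∂(μ.law ρ) = ∫⁻ ω, v ω ∂ν := fun v => by
      rw [← lintegral_indicator (measurable_past k hB)]
      refine lintegral_congr fun ω => ?_
      by_cases hω : past k ω ∈ B <;> simp [hω]
    rw [e, e] at h
    rw [lintegral_map hw (by fun_prop), h, Measure.lintegral_compProd hw,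
      lintegral_map hw.lintegral_kernel_prod_right' (by fun_prop)]
    exact lintegral_congr fun ω => (lintegral_bornMeasure ρ _ _).symm
  have hi : Integrable φ (ν.map (fun ω => (ω k).1) ⊗ₘ bornKernel m ρ) := by
    rw [← key]
    have : IsFiniteMeasure (ν.map fun ω => ω k) := inferInstance
    exact Integrable.of_bound hφ.aestronglyMeasurable C (ae_of_all _ hC)
  calc ∫ ω, φ (ω k) ∂ν = ∫ r, φ r ∂(ν.map fun ω => ω k) :=
        (integral_map (measurable_pi_apply k).aemeasurable hφ.aestronglyMeasurable).symm
    _ = ∫ M, ∫ x, φ (M, x) ∂(bornMeasure ρ M) ∂(ν.map fun ω => (ω k).1) := by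
        rw [key, Measure.integral_compProd hi]; rfl
    _ = ∫ M, ∑ x, bornProb ρ M x * φ (M, x) ∂(ν.map fun ω => (ω k).1) := by
        simp only [integral_bornMeasure]
    _ = _ := integral_map (measurable_pi_apply k).fst.aemeasurable
        (Measurable.aestronglyMeasurable (by fun_prop))

@[fun_prop]
theorem measurable_bornProb_round (ρ : stateSpace d) :
    Measurable fun r : Round d m => bornProb ρ r.1 r.2 :=
  measurable_from_prod_countable_left fun x => measurable_bornProb ρ x

/-- Change of measure between two states along the first `k` rounds. -/
theorem lintegral_past_mul_prod_le (μ : Strategy d m) (ρ σ : stateSpace d) (k : ℕ)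
    {F : (Fin k → Round d m) → ℝ≥0∞} (hF : Measurable F) {r : Round d m → ℝ≥0∞}
    (hr : Measurable r) (hr_top : ∀ q, r q ≠ ∞)
    (h : ∀ M x, ENNReal.ofReal (bornProb ρ M x) * r (M, x) ≤ ENNReal.ofReal (bornProb σ M x)) :
    ∫⁻ ω, F (past k ω) * ∏ i ∈ Finset.range k, r (ω i) ∂(μ.law ρ) ≤
      ∫⁻ ω, F (past k ω) ∂(μ.law σ) := by
  induction k with
  | zero =>
    have hp : ∀ ω : ℕ → Round d m, past 0 ω = Fin.elim0 := fun ω => Subsingleton.elim _ _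
    simp [hp]
  | succ k ih =>
    have hs : Measurable fun q : (Fin k → Round d m) × Round d m =>
        (Fin.snoc q.1 q.2 : Fin (k + 1) → Round d m) := by
      refine measurable_pi_lambda _ fun i => ?_
      refine Fin.lastCases ?_ (fun j => ?_) i
      · simpa using measurable_snd
      · simpa using (measurable_pi_apply j).fun_comp measurable_fst
    have hp : ∀ ω : ℕ → Round d m, past (k + 1) ω = Fin.snoc (past k ω) (ω k) := fun ω => by
      ext1 i
      refine Fin.lastCases ?_ (fun j => ?_) i <;> simp [past]
    have hH : Measurable fun q : (Fin k → Round d m) × Round d m =>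
        F (Fin.snoc q.1 q.2 : Fin (k + 1) → Round d m) := hF.comp hs
    have hprod : ∀ ω : ℕ → Round d m,
        ∏ i ∈ Finset.range k, r (ω i) = ∏ i : Fin k, r (past k ω i) := fun ω =>
      (Finset.prod_range fun i => r (ω i))
    have hG : Measurable fun p : Fin k → Round d m => ∫⁻ M, ∑ x,
        ENNReal.ofReal (bornProb σ M x) * F (Fin.snoc p (M, x) : Fin (k + 1) → Round d m)
          ∂(μ.choice k p) := by
      refine Measurable.lintegral_kernel_prod_right' (κ := μ.choice k)
        (f := fun q : (Fin k → Round d m) × POVM d m => ∑ x, ENNReal.ofReal (bornProb σ q.2 x) *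
          F (Fin.snoc q.1 (q.2, x) : Fin (k + 1) → Round d m)) ?_
      refine Finset.measurable_sum _ fun x _ => Measurable.mul (by fun_prop) ?_
      exact hH.comp (by fun_prop :
        Measurable fun q : (Fin k → Round d m) × POVM d m => (q.1, (q.2, x)))
    simp only [hp, Finset.prod_range_succ, hprod]
    rw [lintegral_law μ σ k (fun p r => F (Fin.snoc p r : Fin (k + 1) → Round d m)) hH]
    -- Averaging `F` over the last round under σ leaves a function of the first `k` rounds, to which
    -- the induction hypothesis applies.
    refine le_trans ?_ (ih hG)
    simp only [hprod]
    rw [lintegral_law μ ρ k (fun p q => F (Fin.snoc p q : Fin (k + 1) → Round d m) *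
      ((∏ i, r (p i)) * r q)) (hH.mul (by fun_prop))]
    refine lintegral_mono fun ω => ?_
    rw [mul_comm, ← lintegral_const_mul' _ _ (by
      exact ENNReal.prod_ne_top fun i _ => hr_top _)]
    refine lintegral_mono fun M => ?_
    rw [Finset.mul_sum]
    refine Finset.sum_le_sum fun x _ => ?_
    calc _ = (∏ i, r (past k ω i)) * ((ENNReal.ofReal (bornProb ρ M x) * r (M, x)) *
          F (Fin.snoc (past k ω) (M, x) : Fin (k + 1) → Round d m)) := by ring
      _ ≤ _ := by gcongr; exact h M x

/-! ### Products of conditional e-values -/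

section Supermartingale

variable (μ : Strategy d m) (ρ : stateSpace d) {w : Fin m → ℝ≥0∞}

/-- The supermartingale property, stated through integrals over events of the past instead of
conditional expectations. -/
theorem setLIntegral_prod_succ_le {c : ℝ≥0∞} {k : ℕ}
    (h : ∀ᵐ ω ∂(μ.law ρ), ∑ x, ENNReal.ofReal (bornProb ρ (ω k).1 x) * w x ≤ c)
    {A : Set (ℕ → Round d m)} (hA : MeasurableSet[pastAlgebra d m k] A) :
    ∫⁻ ω in A, ∏ i ∈ Finset.range (k + 1), w (ω i).2 ∂(μ.law ρ) ≤
      (∫⁻ ω in A, ∏ i ∈ Finset.range k, w (ω i).2 ∂(μ.law ρ)) * c := by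
  obtain ⟨B, hB, rfl⟩ := hA
  have hw : Measurable w := measurable_of_finite w
  have hF : Measurable (B.indicator fun p : Fin k → Round d m => ∏ i, w (p i).2) :=
    Measurable.indicator (by fun_prop) hB
  have hA := measurable_past k hB
  have e : ∀ ω : ℕ → Round d m, (past k ⁻¹' B).indicator
      (fun ω => ∏ i ∈ Finset.range k, w (ω i).2) ω =
        B.indicator (fun p : Fin k → Round d m => ∏ i, w (p i).2) (past k ω) := fun ω => by
    by_cases hω : past k ω ∈ B
    · simp only [Set.mem_preimage, hω, Set.indicator_of_mem]
      exact Finset.prod_range fun i => w (ω i).2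
    · simp [hω]
  rw [← lintegral_indicator hA, ← lintegral_indicator hA, ← lintegral_mul_const _
    ((by fun_prop : Measurable fun ω : ℕ → Round d m =>
      ∏ i ∈ Finset.range k, w (ω i).2).indicator hA)]
  have e' : ∀ ω : ℕ → Round d m, (past k ⁻¹' B).indicator
      (fun ω => ∏ i ∈ Finset.range (k + 1), w (ω i).2) ω =
        B.indicator (fun p : Fin k → Round d m => ∏ i, w (p i).2) (past k ω) * w (ω k).2 :=
    fun ω => by
      rw [← e]
      by_cases hω : past k ω ∈ B <;> simp [hω, Finset.prod_range_succ]
  simp only [e, e']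
  rw [lintegral_past_mul μ ρ k hF (w := fun r => w r.2) (by fun_prop)]
  exact lintegral_mono_ae (h.mono fun ω hω => by gcongr)

theorem lintegral_prod_le_pow {c : ℝ≥0∞}
    (h : ∀ k, ∀ᵐ ω ∂(μ.law ρ), ∑ x, ENNReal.ofReal (bornProb ρ (ω k).1 x) * w x ≤ c) (k : ℕ) :
    ∫⁻ ω, ∏ i ∈ Finset.range k, w (ω i).2 ∂(μ.law ρ) ≤ c ^ k := by
  induction k with
  | zero => simp
  | succ k ih =>
    have := setLIntegral_prod_succ_le μ ρ (h k) (A := Set.univ) MeasurableSet.univ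
    rw [Measure.restrict_univ] at this
    rw [pow_succ]
    exact this.trans (by gcongr)

/-- Ville's inequality for products of conditional e-values. -/
theorem mul_measure_exists_le_prod_le_one
    (h : ∀ k, ∀ᵐ ω ∂(μ.law ρ), ∑ x, ENNReal.ofReal (bornProb ρ (ω k).1 x) * w x ≤ 1) (a : ℝ≥0∞) :
    a * μ.law ρ {ω | ∃ k, a ≤ ∏ i ∈ Finset.range k, w (ω i).2} ≤ 1 := by
  have hw : Measurable w := measurable_of_finite w
  set L : ℕ → (ℕ → Round d m) → ℝ≥0∞ := fun k ω => ∏ i ∈ Finset.range k, w (ω i).2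
  set E : ℕ → Set (ℕ → Round d m) := fun k => {ω | ∃ j ≤ k, a ≤ L j ω} with hE
  have hL : ∀ {j k : ℕ}, j ≤ k → Measurable[pastAlgebra d m k] (L j) := fun {j k} hjk => by
    refine Finset.measurable_prod _ fun i hi => ?_
    exact (hw.comp measurable_snd).comp
      (measurable_pastAlgebra_eval ((Finset.mem_range.1 hi).trans_le hjk))
  have hEm : ∀ k, MeasurableSet[pastAlgebra d m k] (E k) := fun k => by
    have : E k = ⋃ j ∈ Set.Iic k, {ω | a ≤ L j ω} := by ext; simp [hE]
    rw [this]
    exact MeasurableSet.biUnion (Set.to_countable _) fun j hj =>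
      measurableSet_le measurable_const (hL hj)
  have hEm' := fun k => pastAlgebra_le k _ (hEm k)
  have hLm : ∀ j, Measurable (L j) := fun j => (hL le_rfl).mono (pastAlgebra_le j) le_rfl
  -- Optional stopping by hand: paths that have reached level `a` are frozen at `a`, the others
  -- carry the current product, and the total mean never increases.
  have key : ∀ k, a * μ.law ρ (E k) + ∫⁻ ω in (E k)ᶜ, L k ω ∂(μ.law ρ) ≤ 1 := by
    intro k
    induction k with
    | zero =>
      by_cases ha : a ≤ 1
      · have : E 0 = Set.univ := by ext; simp [hE, L, ha]
        simp [this, ha]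
      · have : E 0 = ∅ := by ext; simp [hE, L, lt_of_not_ge ha]
        simp [this, L]
    | succ k ih =>
      refine le_trans ?_ ih
      have hsub : E k ⊆ E (k + 1) := fun ω ⟨j, hj, h⟩ => ⟨j, hj.trans k.le_succ, h⟩
      set N := E (k + 1) \ E k
      have hN : MeasurableSet N := (hEm' _).diff (hEm' _)
      have hEN : E (k + 1) = E k ∪ N := (Set.union_sdiff_cancel hsub).symm
      have hc : (E k)ᶜ = N ∪ (E (k + 1))ᶜ := by
        ext ω
        have := @hsub ω
        simp only [N, Set.mem_compl_iff, Set.mem_union, Set.mem_sdiff]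
        tauto
      have hLN : a * μ.law ρ N ≤ ∫⁻ ω in N, L (k + 1) ω ∂(μ.law ρ) := by
        rw [← setLIntegral_const]
        refine setLIntegral_mono (hLm _) fun ω hω => ?_
        obtain ⟨⟨j, hj, h⟩, hn⟩ := hω
        rcases Nat.le_succ_iff.1 hj with hj | rfl
        · exact absurd ⟨j, hj, h⟩ hn
        · exact h
      calc a * μ.law ρ (E (k + 1)) + ∫⁻ ω in (E (k + 1))ᶜ, L (k + 1) ω ∂(μ.law ρ)
          ≤ a * (μ.law ρ (E k) + μ.law ρ N) + ∫⁻ ω in (E (k + 1))ᶜ, L (k + 1) ω ∂(μ.law ρ) := by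
            gcongr
            rw [hEN]
            exact measure_union_le _ _
        _ ≤ a * μ.law ρ (E k) + (∫⁻ ω in N, L (k + 1) ω ∂(μ.law ρ) +
              ∫⁻ ω in (E (k + 1))ᶜ, L (k + 1) ω ∂(μ.law ρ)) := by
            rw [mul_add, add_assoc]
            gcongr
        _ = a * μ.law ρ (E k) + ∫⁻ ω in (E k)ᶜ, L (k + 1) ω ∂(μ.law ρ) := by
            rw [hc, lintegral_union (hEm' _).compl]
            exact Set.disjoint_compl_right_iff_subset.2 Set.sdiff_subset
        _ ≤ _ := by
            refine add_le_add le_rfl ?_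
            have := setLIntegral_prod_succ_le μ ρ (h k) (hEm k).compl
            rwa [mul_one] at this
  have hU : {ω | ∃ k, a ≤ ∏ i ∈ Finset.range k, w (ω i).2} = ⋃ k, E k := by
    ext ω
    simp only [hE, Set.mem_ofPred_eq, Set.mem_iUnion]
    exact ⟨fun ⟨k, hk⟩ => ⟨k, k, le_rfl, hk⟩, fun ⟨_, j, _, hj⟩ => ⟨j, hj⟩⟩
  have hmono : Monotone E := fun i k hik ω ⟨j, hj, h⟩ => ⟨j, hj.trans hik, h⟩
  rw [hU, hmono.measure_iUnion, ENNReal.mul_iSup]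
  exact iSup_le fun k => le_self_add.trans (key k)

end Supermartingale

/-! ### Domination and divergence of outcome distributions -/

section

open scoped MatrixOrder

theorem re_trace_mul_nonneg {A B : Matrix (Fin d) (Fin d) ℂ} (hA : A.PosSemidef)
    (hB : B.PosSemidef) : 0 ≤ (A * B).trace.re := by
  obtain ⟨C, hC⟩ := CStarAlgebra.nonneg_iff_eq_star_mul_self.mp hA.nonneg
  have h := (hB.mul_mul_conjTranspose_same C).trace_nonneg
  have e : (A * B).trace = (C * B * C.conjTranspose).trace := by
    rw [hC, Matrix.star_eq_conjTranspose, Matrix.mul_assoc, Matrix.trace_mul_comm]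
  rw [e]
  exact (Complex.le_def.1 h).1

theorem exists_pos_smul_one_sub_posSemidef {A : Matrix (Fin d) (Fin d) ℂ} (hA : A.IsHermitian) :
    ∃ c : ℝ, 0 < c ∧ ∀ b : ℝ, c ≤ b → (b • (1 : Matrix (Fin d) (Fin d) ℂ) - A).PosSemidef := by
  obtain ⟨c, hc⟩ := (Matrix.finite_real_spectrum (A := A)).bddAbove
  refine ⟨max c 1, by positivity, fun b hb => ?_⟩
  have h := le_algebraMap_of_spectrum_le (r := b) (a := A)
    (fun x hx => (hc hx).trans ((le_max_left _ _).trans hb)) hA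
  rwa [Matrix.le_iff, Algebra.algebraMap_eq_smul_one] at h

theorem exists_pos_sub_smul_one_posSemidef {A : Matrix (Fin d) (Fin d) ℂ} (hA : A.PosDef) :
    ∃ c : ℝ, 0 < c ∧ (A - c • (1 : Matrix (Fin d) (Fin d) ℂ)).PosSemidef := by
  rcases isEmpty_or_nonempty (Fin d) with h | h
  · refine ⟨1, one_pos, ?_⟩
    rw [Subsingleton.elim (A - _) 0]
    exact .zero
  obtain ⟨c, hc, h⟩ := (CFC.exists_pos_algebraMap_le_iff (A := Matrix (Fin d) (Fin d) ℂ)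
    (a := A) hA.isHermitian).2 fun x hx => hA.isStrictlyPositive.spectrum_pos hx
  rw [Matrix.le_iff, Algebra.algebraMap_eq_smul_one] at h
  exact ⟨c, hc, h⟩

end

/-- If ρ ≥ a·1 and σ ≤ b·1, then σ ≤ (b/a) ρ as operators, so the constant serves all POVMs and all
outcome sets at once. -/
theorem exists_bornProb_le_mul {ρ : stateSpace d} (hρ : ρ.1.PosDef) (σ : stateSpace d) :
    ∃ C : ℝ, 0 < C ∧ ∀ {m : ℕ} (M : POVM d m) (x : Fin m),
      bornProb σ M x ≤ C * bornProb ρ M x := by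
  obtain ⟨a, ha, h₁⟩ := exists_pos_sub_smul_one_posSemidef hρ
  obtain ⟨b, hb, h₂⟩ := exists_pos_smul_one_sub_posSemidef σ.2.1.isHermitian
  refine ⟨b / a, by positivity, fun {m} M x => ?_⟩
  have e₁ := re_trace_mul_nonneg (M.2.1 x) h₁
  have e₂ := re_trace_mul_nonneg (M.2.1 x) (h₂ b le_rfl)
  simp only [Matrix.mul_sub, Matrix.trace_sub, Matrix.mul_smul, Matrix.mul_one,
    Matrix.trace_smul, Complex.sub_re, Complex.real_smul, Complex.re_ofReal_mul,
    sub_nonneg] at e₁ e₂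
  have e₃ : (M.1 x).trace.re ≤ bornProb ρ M x / a := by
    rw [le_div_iff₀ ha, mul_comm]; exact e₁
  calc bornProb σ M x ≤ b * (M.1 x).trace.re := e₂
    _ ≤ b * (bornProb ρ M x / a) := by gcongr
    _ = _ := by ring

theorem bornProb_eq_zero {ρ : stateSpace d} (hρ : ρ.1.PosDef) (σ : stateSpace d) {M : POVM d m}
    {x : Fin m} (h : bornProb ρ M x = 0) : bornProb σ M x = 0 := by
  obtain ⟨C, -, hC⟩ := exists_bornProb_le_mul hρ σ
  have := hC M x
  rw [h, mul_zero] at this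
  exact le_antisymm this (bornProb_nonneg σ M x)

/-- The log-likelihood ratio of the outcome of one round. -/
noncomputable def logRatio (ρ σ : stateSpace d) (r : Round d m) : ℝ :=
  Real.log (bornProb ρ r.1 r.2 / bornProb σ r.1 r.2)

@[fun_prop]
theorem measurable_logRatio (ρ σ : stateSpace d) :
    Measurable (logRatio ρ σ : Round d m → ℝ) :=
  ((measurable_bornProb_round ρ).div (measurable_bornProb_round σ)).log

theorem logRatio_symm (ρ σ : stateSpace d) (r : Round d m) :
    logRatio ρ σ r = -logRatio σ ρ r := by
  rw [logRatio, logRatio, ← Real.log_inv, inv_div]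

theorem exists_abs_logRatio_le {ρ σ : stateSpace d} (hρ : ρ.1.PosDef) (hσ : σ.1.PosDef) :
    ∃ C : ℝ, ∀ {m : ℕ} (r : Round d m), |logRatio ρ σ r| ≤ C := by
  obtain ⟨a, ha, h₁⟩ := exists_bornProb_le_mul hρ σ
  obtain ⟨b, hb, h₂⟩ := exists_bornProb_le_mul hσ ρ
  have key : ∀ {ρ σ : stateSpace d} (_ : σ.1.PosDef) {b : ℝ} (_ : 0 < b)
      (_ : ∀ {m : ℕ} (M : POVM d m) (x : Fin m), bornProb ρ M x ≤ b * bornProb σ M x)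
      {m : ℕ} (r : Round d m), logRatio ρ σ r ≤ |Real.log b| := by
    intro ρ σ _ b hb h m r
    -- If either probability vanishes, the log-ratio takes the default value 0; the absolute value
    -- in the bound covers this case.
    rcases eq_or_lt_of_le (bornProb_nonneg σ r.1 r.2) with h0 | h0
    · simp [logRatio, ← h0]
    rcases eq_or_lt_of_le (bornProb_nonneg ρ r.1 r.2) with h1 | h1
    · simp [logRatio, ← h1]
    refine le_trans (Real.log_le_log (by positivity) ?_) (le_abs_self _)
    rw [div_le_iff₀ h0]
    exact h r.1 r.2
  refine ⟨max |Real.log a| |Real.log b|, fun {m} r => abs_le.2 ⟨?_, ?_⟩⟩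
  · rw [logRatio_symm]
    exact neg_le_neg ((key hρ ha h₁ r).trans (le_max_left _ _))
  · exact (key hσ hb h₂ r).trans (le_max_right _ _)

theorem bornMeasure_singleton (ρ : stateSpace d) (M : POVM d m) (x : Fin m) :
    bornMeasure ρ M {x} = ENNReal.ofReal (bornProb ρ M x) := by
  have := lintegral_bornMeasure ρ M (Set.indicator {x} 1)
  rw [lintegral_indicator_one (measurableSet_singleton x)] at this
  rw [this, Finset.sum_eq_single x] <;> simp +contextual

/-- Full rank of σ gives absolute continuity for every POVM. The default values of `logRatio` do no
harm, since they occur only at outcomes that are null under ρ. -/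
theorem klDiv_bornMeasure (ρ : stateSpace d) {σ : stateSpace d} (hσ : σ.1.PosDef) (M : POVM d m) :
    InformationTheory.klDiv (bornMeasure ρ M) (bornMeasure σ M) =
      ENNReal.ofReal (∑ x, bornProb ρ M x * logRatio ρ σ (M, x)) := by
  have hd : bornMeasure ρ M = (bornMeasure σ M).withDensity fun x =>
      ENNReal.ofReal (bornProb ρ M x / bornProb σ M x) := by
    refine Measure.ext_of_singleton fun x => ?_
    rw [withDensity_apply _ (measurableSet_singleton x), lintegral_singleton,
      bornMeasure_singleton, bornMeasure_singleton,
      ← ENNReal.ofReal_mul' (bornProb_nonneg σ M x)]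
    congr 1
    rcases eq_or_ne (bornProb σ M x) 0 with h | h
    · simp [h, bornProb_eq_zero hσ ρ h]
    · rw [div_mul_cancel₀ _ h]
  have hac : bornMeasure ρ M ≪ bornMeasure σ M := by
    rw [hd]; exact withDensity_absolutelyContinuous _ _
  have hrn : (bornMeasure ρ M).rnDeriv (bornMeasure σ M) =ᵐ[bornMeasure σ M] fun x =>
      ENNReal.ofReal (bornProb ρ M x / bornProb σ M x) := by
    conv_lhs => rw [hd]
    exact Measure.rnDeriv_withDensity _ (measurable_of_finite _)
  have hllr : llr (bornMeasure ρ M) (bornMeasure σ M) =ᵐ[bornMeasure ρ M] fun x =>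
      logRatio ρ σ (M, x) := by
    filter_upwards [hac.ae_le hrn] with x hx
    rw [llr, hx, ENNReal.toReal_ofReal
      (div_nonneg (bornProb_nonneg ρ M x) (bornProb_nonneg σ M x)), logRatio]
  rw [InformationTheory.klDiv_of_ac_of_integrable hac Integrable.of_finite,
    integral_congr_ae hllr, integral_bornMeasure]
  simp

/-! ### Stopping times -/

/-- The event that the test has not stopped during the first `k` rounds. -/
def DecisionRule.running (δ : DecisionRule d m) (k : ℕ) : Set (ℕ → Round d m) :=
  {ω | ∀ j < k, δ.verdict ω j = Verdict.continue}

/-- The event that the test stops in round `k` with the verdict `v`. -/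
def DecisionRule.stopsAt (δ : DecisionRule d m) (v : Verdict) (k : ℕ) : Set (ℕ → Round d m) :=
  δ.running k ∩ {ω | δ.verdict ω k = v}

namespace DecisionRule

variable (δ : DecisionRule d m)

theorem measurableSet_verdict {j k : ℕ} (h : j < k) (v : Verdict) :
    MeasurableSet[pastAlgebra d m k] {ω | δ.verdict ω j = v} := by
  have : Measurable[pastAlgebra d m k] fun (ω : ℕ → Round d m) (i : Finset.Iic j) => ω i :=
    @measurable_pi_lambda _ _ _ (pastAlgebra d m k) _ _ fun i =>
      measurable_pastAlgebra_eval ((Finset.mem_Iic.1 i.2).trans_lt h)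
  exact this (δ.measurableSet_decide j v)

theorem measurableSet_running_of_le {j k : ℕ} (h : j ≤ k) :
    MeasurableSet[pastAlgebra d m k] (δ.running j) := by
  have : δ.running j = ⋂ i ∈ Set.Iio j, {ω | δ.verdict ω i = Verdict.continue} := by
    ext; simp [running]
  rw [this]
  exact @MeasurableSet.biInter _ _ (pastAlgebra d m k) _ _ (Set.to_countable _) fun i hi =>
    δ.measurableSet_verdict (hi.trans_le h) _

theorem measurableSet_stopsAt (v : Verdict) (k : ℕ) :
    MeasurableSet[pastAlgebra d m (k + 1)] (δ.stopsAt v k) :=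
  @MeasurableSet.inter _ (pastAlgebra d m (k + 1)) _ _ (δ.measurableSet_running_of_le k.le_succ)
    (δ.measurableSet_verdict k.lt_succ_self v)

theorem measurableSet_running' (k : ℕ) : MeasurableSet (δ.running k) :=
  pastAlgebra_le k _ (δ.measurableSet_running_of_le le_rfl)

theorem measurableSet_stopsAt' (v : Verdict) (k : ℕ) : MeasurableSet (δ.stopsAt v k) :=
  pastAlgebra_le (k + 1) _ (δ.measurableSet_stopsAt v k)

theorem mem_running_iff_le {ω : ℕ → Round d m} {k : ℕ} (h : ω ∈ δ.running k)
    (hk : δ.verdict ω k ≠ Verdict.continue) (j : ℕ) : ω ∈ δ.running j ↔ j ≤ k :=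
  ⟨fun hj => le_of_not_gt fun hlt => hk (hj k hlt), fun hj i hi => h i (hi.trans_le hj)⟩

theorem exists_of_notMem_running {ω : ℕ → Round d m} {N : ℕ} (h : ω ∉ δ.running N) :
    ∃ k < N, ω ∈ δ.running k ∧ δ.verdict ω k ≠ Verdict.continue := by
  classical
  have h' : ∃ j, j < N ∧ δ.verdict ω j ≠ Verdict.continue := by
    simpa [running] using h
  refine ⟨Nat.find h', (Nat.find_spec h').1, fun j hj => ?_, (Nat.find_spec h').2⟩
  by_contra hc
  exact Nat.find_min h' hj ⟨hj.trans (Nat.find_spec h').1, hc⟩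

theorem stoppingTime_eq {ω : ℕ → Round d m} {k : ℕ} (h : ω ∈ δ.running k)
    (hk : δ.verdict ω k ≠ Verdict.continue) : δ.stoppingTime ω = ((k + 1 : ℕ) : ℕ∞) := by
  refine le_antisymm (iInf₂_le k hk) (le_iInf₂ fun j hj => ?_)
  have : k ≤ j := le_of_not_gt fun hlt => hj (h j hlt)
  exact_mod_cast Nat.succ_le_succ this

theorem stoppingTime_eq_top {ω : ℕ → Round d m} (h : ∀ k, ω ∈ δ.running k) :
    δ.stoppingTime ω = ⊤ := by
  refine le_antisymm le_top (le_iInf₂ fun j hj => absurd (h (j + 1) j j.lt_succ_self) hj)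

theorem declares_eq_iUnion {v : Verdict} (hv : v ≠ Verdict.continue) :
    δ.declares v = ⋃ k, δ.stopsAt v k := by
  ext ω
  simp only [declares, Set.mem_ofPred_eq, Set.mem_iUnion, stopsAt, Set.mem_inter_iff]
  refine exists_congr fun k => ⟨fun ⟨h, hk⟩ => ⟨?_, hk⟩, fun ⟨h, hk⟩ =>
    ⟨δ.stoppingTime_eq h (hk.trans_ne hv), hk⟩⟩
  by_contra hr
  obtain ⟨j, hj, hjr, hjv⟩ := δ.exists_of_notMem_running hr
  rw [δ.stoppingTime_eq hjr hjv] at h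
  have : j + 1 = k + 1 := by exact_mod_cast h
  omega

/-- `running k` is the event `T > k`, so this is the tail-sum formula for the stopping time, valid
also when it is infinite. -/
theorem stoppingTime_eq_tsum (ω : ℕ → Round d m) :
    (δ.stoppingTime ω : ℝ≥0∞) = ∑' k, (δ.running k).indicator 1 ω := by
  by_cases h : ∀ k, ω ∈ δ.running k
  · rw [δ.stoppingTime_eq_top h]
    simp [h]
  · push Not at h
    obtain ⟨N, hN⟩ := h
    obtain ⟨k, -, hk, hkv⟩ := δ.exists_of_notMem_running hN
    rw [δ.stoppingTime_eq hk hkv, tsum_eq_sum (s := Finset.range (k + 1))]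
    · rw [Finset.sum_congr rfl (g := fun _ => 1)]
      · simp
      · intro j hj
        simp [(δ.mem_running_iff_le hk hkv j).2 (Nat.lt_succ_iff.1 (Finset.mem_range.1 hj))]
    · intro j hj
      have : ω ∉ δ.running j := fun h => hj
        (Finset.mem_range.2 (Nat.lt_succ_of_le ((δ.mem_running_iff_le hk hkv j).1 h)))
      simp [this]

theorem lintegral_stoppingTime (P : Measure (ℕ → Round d m)) :
    ∫⁻ ω, (δ.stoppingTime ω : ℝ≥0∞) ∂P = ∑' k, P (δ.running k) := by
  simp only [δ.stoppingTime_eq_tsum]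
  rw [lintegral_tsum fun k => (measurable_one.indicator (δ.measurableSet_running' k)).aemeasurable]
  exact tsum_congr fun k => lintegral_indicator_one (δ.measurableSet_running' k)

end DecisionRule

/-! ### The converse bound -/

/-- The log-likelihood ratio of the rounds before the test stops, truncated at round `N`. -/
noncomputable def stoppedLogRatio (δ : DecisionRule d m) (ρ σ : stateSpace d) (N : ℕ)
    (ω : ℕ → Round d m) : ℝ :=
  ∑ k ∈ Finset.range N, (δ.running k).indicator (fun ω => logRatio ρ σ (ω k)) ω

/-- Equality holds unless the outcome is null under ρ; there the left side vanishes. -/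
theorem ofReal_bornProb_mul_exp_le {ρ σ : stateSpace d} (hσ : σ.1.PosDef) (M : POVM d m)
    (x : Fin m) :
    ENNReal.ofReal (bornProb ρ M x) * ENNReal.ofReal (Real.exp (-logRatio ρ σ (M, x))) ≤
      ENNReal.ofReal (bornProb σ M x) := by
  rw [← ENNReal.ofReal_mul (bornProb_nonneg ρ M x)]
  refine ENNReal.ofReal_le_ofReal ?_
  rcases eq_or_lt_of_le (bornProb_nonneg ρ M x) with h | h
  · simpa [← h] using bornProb_nonneg σ M x
  have h' : 0 < bornProb σ M x := by
    refine lt_of_le_of_ne (bornProb_nonneg σ M x) fun h0 => h.ne' (bornProb_eq_zero hσ ρ h0.symm)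
  rw [logRatio, Real.exp_neg, Real.exp_log (by positivity), inv_div, mul_div_cancel₀ _ h.ne']

/-- The inverse likelihood ratio transports ρ to σ on events of the first `k` rounds; mass that σ
gives to outcomes null under ρ is lost, whence only an inequality. -/
theorem setLIntegral_exp_le (μ : Strategy d m) (ρ : stateSpace d) {σ : stateSpace d}
    (hσ : σ.1.PosDef) {k : ℕ} {A : Set (ℕ → Round d m)} (hA : MeasurableSet[pastAlgebra d m k] A) :
    ∫⁻ ω in A, ENNReal.ofReal (Real.exp (-∑ i ∈ Finset.range k, logRatio ρ σ (ω i))) ∂(μ.law ρ) ≤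
      μ.law σ A := by
  obtain ⟨B, hB, rfl⟩ := hA
  have h := lintegral_past_mul_prod_le μ ρ σ k (F := B.indicator 1) (measurable_one.indicator hB)
    (r := fun q => ENNReal.ofReal (Real.exp (-logRatio ρ σ q))) (by fun_prop)
    (fun _ => ENNReal.ofReal_ne_top) (ofReal_bornProb_mul_exp_le hσ)
  have hA := measurable_past k hB
  rw [← lintegral_indicator hA, ← lintegral_indicator_one hA]
  refine le_trans (le_of_eq ?_) h
  refine lintegral_congr fun ω => ?_
  by_cases hω : past k ω ∈ B
  · simp only [Set.mem_preimage, hω, Set.indicator_of_mem, Pi.one_apply, one_mul]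
    rw [← Finset.sum_neg_distrib, Real.exp_sum,
      ENNReal.ofReal_prod_of_nonneg fun _ _ => (Real.exp_pos _).le]
  · simp [hω]

/-- Change of measure at the stopping time. The space splits into `running N`, the events of
stopping with `v` in a round before `N`, and those of stopping with the other verdict. Each piece is
determined by the rounds entering the stopped log-ratio on it, so `setLIntegral_exp_le` applies
piece by piece; the pieces without verdict `v` have total σ-mass at most 1. -/
theorem lintegral_exp_stoppedLogRatio_le (μ : Strategy d m) (δ : DecisionRule d m)
    (ρ : stateSpace d) {σ : stateSpace d} (hσ : σ.1.PosDef) {v : Verdict}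
    (hv : v ≠ Verdict.continue) (a : ℝ) (N : ℕ) :
    ∫⁻ ω, ENNReal.ofReal (Real.exp (a * (⋃ k ∈ Finset.range N, δ.stopsAt v k).indicator 1 ω -
        stoppedLogRatio δ ρ σ N ω)) ∂(μ.law ρ) ≤
      1 + ENNReal.ofReal (Real.exp a) * μ.law σ (⋃ k ∈ Finset.range N, δ.stopsAt v k) := by
  classical
  set A := ⋃ k ∈ Finset.range N, δ.stopsAt v k with hA_def
  set b := ENNReal.ofReal (Real.exp a) with hb_def
  set Lk : ℕ → (ℕ → Round d m) → ℝ≥0∞ := fun k ω =>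
    ENNReal.ofReal (Real.exp (-∑ i ∈ Finset.range k, logRatio ρ σ (ω i))) with hLk
  -- The test stops in round `k` with the terminal verdict other than `v`.
  set Q : ℕ → Set (ℕ → Round d m) := fun k =>
    (δ.running k \ δ.running (k + 1)) \ δ.stopsAt v k
    with hQ_def
  have hQ : ∀ k, MeasurableSet[pastAlgebra d m (k + 1)] (Q k) := fun k =>
    @MeasurableSet.diff _ (pastAlgebra d m (k + 1)) _ _
      (@MeasurableSet.diff _ (pastAlgebra d m (k + 1)) _ _
        (δ.measurableSet_running_of_le k.le_succ) (δ.measurableSet_running_of_le le_rfl))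
      (δ.measurableSet_stopsAt v k)
  have hQ' : ∀ k, MeasurableSet (Q k) := fun k => pastAlgebra_le (k + 1) _ (hQ k)
  have hLm : ∀ k, Measurable (Lk k) := fun k => by fun_prop
  have hsA : ∀ k ω, ω ∈ δ.stopsAt v k → ω ∈ δ.running k ∧ δ.verdict ω k ≠ Verdict.continue :=
    fun k ω h => ⟨h.1, h.2.trans_ne hv⟩
  have hsQ : ∀ k ω, ω ∈ Q k → ω ∈ δ.running k ∧ δ.verdict ω k ≠ Verdict.continue := by
    refine fun k ω h => ⟨h.1.1, fun hc => h.1.2 fun j hj => ?_⟩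
    rcases Nat.lt_succ_iff_lt_or_eq.1 hj with hj | rfl
    · exact h.1.1 j hj
    · exact hc
  have huniq : ∀ {k j ω}, ω ∈ δ.running k → δ.verdict ω k ≠ Verdict.continue →
      ω ∈ δ.running j → δ.verdict ω j ≠ Verdict.continue → j = k := fun h₁ h₂ h₃ h₄ =>
    le_antisymm ((δ.mem_running_iff_le h₁ h₂ _).1 h₃) ((δ.mem_running_iff_le h₃ h₄ _).1 h₁)
  -- pointwise decomposition according to the stopping time
  have hpt : ∀ ω, ENNReal.ofReal (Real.exp (a * A.indicator 1 ω - stoppedLogRatio δ ρ σ N ω)) ≤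
      (δ.running N).indicator (Lk N) ω + ∑ k ∈ Finset.range N,
        (b * (δ.stopsAt v k).indicator (Lk (k + 1)) ω + (Q k).indicator (Lk (k + 1)) ω) := by
    intro ω
    by_cases hN : ω ∈ δ.running N
    · have hA : ω ∉ A := by
        simp only [hA_def, Set.mem_iUnion, not_exists, Finset.mem_range]
        exact fun k hk h => (hsA k ω h).2 (hN k hk)
      have hZ : stoppedLogRatio δ ρ σ N ω = ∑ i ∈ Finset.range N, logRatio ρ σ (ω i) := by
        refine Finset.sum_congr rfl fun k hk => Set.indicator_of_mem ?_ _
        exact fun j hj => hN j (hj.trans (Finset.mem_range.1 hk))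
      rw [Set.indicator_of_notMem hA, hZ, Set.indicator_of_mem hN, mul_zero, zero_sub]
      exact le_self_add
    · obtain ⟨k, hk, hkr, hkv⟩ := δ.exists_of_notMem_running hN
      -- The outcome of the stopping round `k` itself is counted, so `k + 1` rounds contribute.
      have hZ : stoppedLogRatio δ ρ σ N ω = ∑ i ∈ Finset.range (k + 1), logRatio ρ σ (ω i) := by
        rw [stoppedLogRatio, ← Finset.sum_subset (Finset.range_subset_range.2 hk)]
        · refine Finset.sum_congr rfl fun j hj => Set.indicator_of_mem ?_ _
          exact (δ.mem_running_iff_le hkr hkv j).2 (Nat.lt_succ_iff.1 (Finset.mem_range.1 hj))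
        · intro j _ hj
          refine Set.indicator_of_notMem (fun h => hj ?_) _
          exact Finset.mem_range.2 (Nat.lt_succ_of_le ((δ.mem_running_iff_le hkr hkv j).1 h))
      refine le_trans ?_ le_add_self
      refine le_trans ?_ (Finset.single_le_sum (fun _ _ => zero_le) (Finset.mem_range.2 hk))
      rw [hZ]
      by_cases hs : ω ∈ δ.stopsAt v k
      · have hA : ω ∈ A := Set.mem_biUnion (Finset.mem_range.2 hk) hs
        rw [Set.indicator_of_mem hA, Set.indicator_of_mem hs, sub_eq_add_neg, Real.exp_add,
          ENNReal.ofReal_mul (Real.exp_pos _).le, Pi.one_apply, mul_one]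
        exact le_self_add
      · have hA : ω ∉ A := by
          simp only [hA_def, Set.mem_iUnion, not_exists]
          intro j _ h
          obtain rfl := huniq hkr hkv (hsA j ω h).1 (hsA j ω h).2
          exact hs h
        have hq : ω ∈ Q k := ⟨⟨hkr, fun h => hkv (h k k.lt_succ_self)⟩, hs⟩
        rw [Set.indicator_of_notMem hA, Set.indicator_of_mem hq, mul_zero, zero_sub]
        exact le_add_self
  have hdisj : ∀ ω, (δ.running N).indicator 1 ω + ∑ k ∈ Finset.range N, (Q k).indicator 1 ω ≤
      (1 : ℝ≥0∞) := by
    intro ω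
    by_cases hN : ω ∈ δ.running N
    · rw [Set.indicator_of_mem hN, Finset.sum_eq_zero, add_zero, Pi.one_apply]
      exact fun k hk => Set.indicator_of_notMem
        (fun h => (hsQ k ω h).2 (hN k (Finset.mem_range.1 hk))) _
    · rw [Set.indicator_of_notMem hN, zero_add]
      obtain ⟨k, hk, hkr, hkv⟩ := δ.exists_of_notMem_running hN
      rw [Finset.sum_eq_single k]
      · exact Set.indicator_le_self' (fun _ _ => zero_le) ω
      · exact fun j _ hj => Set.indicator_of_notMem
          (fun h => hj (huniq hkr hkv (hsQ j ω h).1 (hsQ j ω h).2)) _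
      · exact fun h => absurd (Finset.mem_range.2 hk) h
  have hU : ∑ k ∈ Finset.range N, μ.law σ (δ.stopsAt v k) = μ.law σ A := by
    rw [hA_def, measure_biUnion_finset]
    · intro j _ k _ hjk
      refine Set.disjoint_left.2 fun ω h₁ h₂ => hjk ?_
      exact huniq (hsA k ω h₂).1 (hsA k ω h₂).2 (hsA j ω h₁).1 (hsA j ω h₁).2
    · exact fun k _ => δ.measurableSet_stopsAt' v k
  calc _ ≤ ∫⁻ ω, ((δ.running N).indicator (Lk N) ω + ∑ k ∈ Finset.range N,
        (b * (δ.stopsAt v k).indicator (Lk (k + 1)) ω + (Q k).indicator (Lk (k + 1)) ω))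
          ∂(μ.law ρ) := lintegral_mono hpt
    _ = ∫⁻ ω in δ.running N, Lk N ω ∂(μ.law ρ) + ∑ k ∈ Finset.range N,
          (b * ∫⁻ ω in δ.stopsAt v k, Lk (k + 1) ω ∂(μ.law ρ) +
            ∫⁻ ω in Q k, Lk (k + 1) ω ∂(μ.law ρ)) := by
        have m₁ := fun k => (hLm (k + 1)).indicator (δ.measurableSet_stopsAt' v k)
        have m₂ := fun k => (hLm (k + 1)).indicator (hQ' k)
        rw [lintegral_add_left ((hLm N).indicator (δ.measurableSet_running' N)),
          lintegral_indicator (δ.measurableSet_running' N),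
          lintegral_finsetSum _ fun k _ => ((m₁ k).const_mul b).fun_add (m₂ k)]
        congr 1
        refine Finset.sum_congr rfl fun k _ => ?_
        rw [lintegral_add_left ((m₁ k).const_mul b), lintegral_const_mul _ (m₁ k),
          lintegral_indicator (δ.measurableSet_stopsAt' v k), lintegral_indicator (hQ' k)]
    _ ≤ μ.law σ (δ.running N) + ∑ k ∈ Finset.range N,
          (b * μ.law σ (δ.stopsAt v k) + μ.law σ (Q k)) := by
        refine add_le_add (setLIntegral_exp_le μ ρ hσ (δ.measurableSet_running_of_le le_rfl))
          (Finset.sum_le_sum fun k _ => add_le_add ?_ ?_)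
        · exact mul_le_mul_right
            (setLIntegral_exp_le μ ρ hσ (δ.measurableSet_stopsAt v k)) b
        · exact setLIntegral_exp_le μ ρ hσ (hQ k)
    _ = (μ.law σ (δ.running N) + ∑ k ∈ Finset.range N, μ.law σ (Q k)) + b * μ.law σ A := by
        rw [Finset.sum_add_distrib, ← Finset.mul_sum, hU]
        ring
    _ ≤ 1 + b * μ.law σ A := by
        gcongr
        calc _ = ∫⁻ ω, ((δ.running N).indicator 1 ω + ∑ k ∈ Finset.range N,
              (Q k).indicator 1 ω) ∂(μ.law σ) := by
              rw [lintegral_add_left (measurable_one.indicator (δ.measurableSet_running' N)),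
                lintegral_finsetSum _ fun k _ => measurable_one.indicator (hQ' k),
                lintegral_indicator_one (δ.measurableSet_running' N)]
              simp_rw [lintegral_indicator_one (hQ' _)]
          _ ≤ ∫⁻ _, 1 ∂(μ.law σ) := lintegral_mono hdisj
          _ = 1 := by simp

theorem integrable_stoppedLogRatio (P : Measure (ℕ → Round d m)) [IsFiniteMeasure P]
    (δ : DecisionRule d m) {ρ σ : stateSpace d} (hρ : ρ.1.PosDef) (hσ : σ.1.PosDef) (k : ℕ) :
    Integrable ((δ.running k).indicator fun ω => logRatio ρ σ (ω k)) P := by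
  obtain ⟨C, hC⟩ := exists_abs_logRatio_le hρ hσ
  exact (Integrable.of_bound (Measurable.aestronglyMeasurable (by fun_prop)) C
    (ae_of_all _ fun ω => hC (ω k))).indicator (δ.measurableSet_running' k)

/-- The expected log-likelihood ratio at the stopping time is at most the divergence per round
times the expected number of rounds. -/
theorem integral_stoppedLogRatio_le (μ : Strategy d m) (δ : DecisionRule d m) {ρ σ : stateSpace d}
    (hρ : ρ.1.PosDef) (hσ : σ.1.PosDef) {c : ℝ}
    (hc : ∀ M : POVM d m, ∑ x, bornProb ρ M x * logRatio ρ σ (M, x) ≤ c) (N : ℕ) :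
    ∫ ω, stoppedLogRatio δ ρ σ N ω ∂(μ.law ρ) ≤
      c * ∑ k ∈ Finset.range N, (μ.law ρ).real (δ.running k) := by
  obtain ⟨C, hC⟩ := exists_abs_logRatio_le hρ hσ
  unfold stoppedLogRatio
  rw [integral_finsetSum _ fun k _ => integrable_stoppedLogRatio _ δ hρ hσ k, Finset.mul_sum]
  refine Finset.sum_le_sum fun k _ => ?_
  -- Wald's argument: reaching round `k` is decided by earlier rounds, so on that event the
  -- log-ratio has conditional mean at most `c`, whichever POVM is chosen.
  rw [integral_indicator (δ.measurableSet_running' k),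
    setIntegral_born μ ρ (δ.measurableSet_running_of_le le_rfl) (by fun_prop) hC]
  calc _ ≤ ∫ ω in δ.running k, c ∂(μ.law ρ) := by
        refine integral_mono (Integrable.of_bound (C := C)
          (Measurable.aestronglyMeasurable (by fun_prop)) (ae_of_all _ fun ω => ?_))
          (integrable_const c) fun ω => hc _
        calc ‖∑ x, bornProb ρ (ω k).1 x * logRatio ρ σ ((ω k).1, x)‖
            ≤ ∑ x, ‖bornProb ρ (ω k).1 x * logRatio ρ σ ((ω k).1, x)‖ := norm_sum_le _ _
          _ ≤ ∑ x, bornProb ρ (ω k).1 x * C := by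
              refine Finset.sum_le_sum fun x _ => ?_
              rw [norm_mul, Real.norm_of_nonneg (bornProb_nonneg _ _ _)]
              exact mul_le_mul_of_nonneg_left (hC _) (bornProb_nonneg _ _ _)
          _ = C := by rw [← Finset.sum_mul, sum_bornProb, one_mul]
    _ = _ := by simp [mul_comm]

/-- A test whose verdict `v` is likely under `ρ` and unlikely under `σ` needs many rounds. -/
theorem mul_law_declares_le (μ : Strategy d m) (δ : DecisionRule d m) {ρ σ : stateSpace d}
    (hρ : ρ.1.PosDef) (hσ : σ.1.PosDef) {v : Verdict} (hv : v ≠ Verdict.continue) {a c : ℝ}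
    (ha : 0 ≤ a) (hc : 0 ≤ c) (hcM : ∀ M : POVM d m,
      ∑ x, bornProb ρ M x * logRatio ρ σ (M, x) ≤ c) :
    ENNReal.ofReal a * μ.law ρ (δ.declares v) ≤
      ENNReal.ofReal c * ∫⁻ ω, (δ.stoppingTime ω : ℝ≥0∞) ∂(μ.law ρ) +
        ENNReal.ofReal (Real.exp a) * μ.law σ (δ.declares v) := by
  set A : ℕ → Set (ℕ → Round d m) := fun N => ⋃ k ∈ Finset.range N, δ.stopsAt v k with hA_def
  have hAm : ∀ N, MeasurableSet (A N) := fun N =>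
    Finset.measurableSet_biUnion _ fun k _ => δ.measurableSet_stopsAt' v k
  have hA : ⋃ k, δ.stopsAt v k = ⋃ N, A N := by
    ext ω
    simp only [hA_def, Set.mem_iUnion, Finset.mem_range, exists_prop]
    exact ⟨fun ⟨k, h⟩ => ⟨k + 1, k, k.lt_succ_self, h⟩, fun ⟨_, k, _, h⟩ => ⟨k, h⟩⟩
  have hmono : Monotone A := fun i j hij =>
    Set.biUnion_subset_biUnion_left fun k hk => Finset.mem_range.2
      ((Finset.mem_range.1 hk).trans_le hij)
  have key : ∀ N, a * (μ.law ρ).real (A N) ≤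
      c * ∑ k ∈ Finset.range N, (μ.law ρ).real (δ.running k) +
        Real.exp a * (μ.law σ).real (A N) := by
    intro N
    set f : (ℕ → Round d m) → ℝ := fun ω => a * (A N).indicator (1 : (ℕ → Round d m) → ℝ) ω -
      stoppedLogRatio δ ρ σ N ω
      with hf_def
    have hZi : Integrable (stoppedLogRatio δ ρ σ N) (μ.law ρ) :=
      integrable_finsetSum _ fun k _ => integrable_stoppedLogRatio _ δ hρ hσ k
    have hIi : Integrable (fun ω => a * (A N).indicator (1 : (ℕ → Round d m) → ℝ) ω) (μ.law ρ) :=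
      ((integrable_const (1 : ℝ)).indicator (hAm N)).const_mul a
    have hfi : Integrable f (μ.law ρ) := hIi.sub hZi
    have h := lintegral_exp_stoppedLogRatio_le μ δ ρ hσ hv a N
    have hfin' : ENNReal.ofReal (Real.exp a) * μ.law σ (A N) ≠ ∞ :=
      ENNReal.mul_ne_top ENNReal.ofReal_ne_top (measure_ne_top _ _)
    have hfin : 1 + ENNReal.ofReal (Real.exp a) * μ.law σ (A N) ≠ ∞ :=
      ENNReal.add_ne_top.2 ⟨ENNReal.one_ne_top, hfin'⟩
    have hei : Integrable (fun ω => Real.exp (f ω)) (μ.law ρ) :=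
      ⟨Real.continuous_exp.comp_aestronglyMeasurable hfi.1,
        (hasFiniteIntegral_iff_ofReal (ae_of_all _ fun ω => (Real.exp_pos _).le)).2
          (h.trans_lt hfin.lt_top)⟩
    -- The bound 1 + x ≤ e^x, applied to a 1_A − Z, replaces a data-processing inequality for the
    -- verdict.
    have h₁ : ∫ ω, (f ω + 1) ∂(μ.law ρ) ≤ ∫ ω, Real.exp (f ω) ∂(μ.law ρ) :=
      integral_mono (hfi.add (integrable_const 1)) hei fun ω => Real.add_one_le_exp _
    have h₂ : ∫ ω, Real.exp (f ω) ∂(μ.law ρ) ≤ 1 + Real.exp a * (μ.law σ).real (A N) := by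
      rw [integral_eq_lintegral_of_nonneg_ae (ae_of_all _ fun ω => (Real.exp_pos _).le) hei.1]
      refine (ENNReal.toReal_mono hfin h).trans (le_of_eq ?_)
      rw [ENNReal.toReal_add ENNReal.one_ne_top hfin', ENNReal.toReal_mul,
        ENNReal.toReal_ofReal (Real.exp_pos a).le]
      rfl
    have h₃ : ∫ ω, (f ω + 1) ∂(μ.law ρ) = a * (μ.law ρ).real (A N) -
        ∫ ω, stoppedLogRatio δ ρ σ N ω ∂(μ.law ρ) + 1 := by
      rw [integral_add hfi (integrable_const 1), hf_def, integral_sub hIi hZi,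
        integral_const_mul, integral_indicator_one (hAm N)]
      simp
    have h₄ := integral_stoppedLogRatio_le μ δ hρ hσ hcM N
    linarith
  have hm : ∀ (τ : stateSpace d) (B : Set (ℕ → Round d m)),
      ENNReal.ofReal ((μ.law τ).real B) = μ.law τ B := fun τ B =>
    ofReal_measureReal (measure_ne_top _ _)
  rw [δ.lintegral_stoppingTime, δ.declares_eq_iUnion hv, hA, hmono.measure_iUnion,
    hmono.measure_iUnion, ENNReal.mul_iSup]
  refine iSup_le fun N => ?_
  have h := ENNReal.ofReal_le_ofReal (key N)
  rw [ENNReal.ofReal_add (by positivity) (by positivity), ENNReal.ofReal_mul ha,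
    ENNReal.ofReal_mul hc, ENNReal.ofReal_mul (Real.exp_pos a).le,
    ENNReal.ofReal_sum_of_nonneg fun _ _ => measureReal_nonneg] at h
  simp only [hm] at h
  refine h.trans (add_le_add (mul_le_mul_right (ENNReal.sum_le_tsum _) _)
    (mul_le_mul_right (le_iSup (fun N => μ.law σ (A N)) N) _))

/-! ### From the converse inequality to error exponents -/

theorem coe_le_rate_iff {n : ℕ} (hn : n ≠ 0) (R : ℝ) (x : ℝ≥0∞) :
    (R : EReal) ≤ ((1 / n : ℝ) : EReal) * ENNReal.log x⁻¹ ↔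
      x ≤ ENNReal.ofReal (Real.exp (-(n * R))) := by
  have hn' : (0 : ℝ) < n := by positivity
  have e : ((1 / n : ℝ) : EReal) * ENNReal.log x⁻¹ = ENNReal.log x⁻¹ / ((n : ℝ) : EReal) := by
    rw [one_div, EReal.coe_inv, mul_comm, EReal.div_eq_inv_mul, mul_comm]
  rw [e, EReal.le_div_iff_mul_le (EReal.coe_pos.2 hn') (EReal.coe_ne_top _), ENNReal.log_inv,
    EReal.le_neg, ← EReal.exp_coe, ← EReal.exp_le_exp_iff, ENNReal.exp_log, EReal.coe_neg,
    EReal.coe_mul, mul_comm]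

namespace DecisionRule

variable (δ : DecisionRule d m)

theorem measurable_stoppingTime :
    Measurable fun ω : ℕ → Round d m => (δ.stoppingTime ω : ℝ≥0∞) := by
  simp only [δ.stoppingTime_eq_tsum]
  exact Measurable.tsum fun k => measurable_one.indicator (δ.measurableSet_running' k)

/-- A finite mean forces the test to stop almost surely, hence to announce one of the two verdicts.
-/
theorem one_le_declares_add (P : Measure (ℕ → Round d m)) [IsProbabilityMeasure P]
    (h : ∫⁻ ω, (δ.stoppingTime ω : ℝ≥0∞) ∂P ≠ ∞) :
    1 ≤ P (δ.declares Verdict.null) + P (δ.declares Verdict.alt) := by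
  have hae : ∀ᵐ ω ∂P, ω ∈ δ.declares Verdict.null ∪ δ.declares Verdict.alt := by
    filter_upwards [ae_lt_top δ.measurable_stoppingTime h] with ω hω
    by_cases hr : ∀ k, ω ∈ δ.running k
    · simp [δ.stoppingTime_eq_top hr] at hω
    push Not at hr
    obtain ⟨N, hN⟩ := hr
    obtain ⟨k, -, hk, hkv⟩ := δ.exists_of_notMem_running hN
    have hT := δ.stoppingTime_eq hk hkv
    rcases hv : δ.verdict ω k with _ | _ | _
    · exact Or.inl ⟨k, hT, hv⟩
    · exact Or.inr ⟨k, hT, hv⟩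
    · exact absurd hv hkv
  calc (1 : ℝ≥0∞) = P Set.univ := measure_univ.symm
    _ ≤ P (δ.declares Verdict.null ∪ δ.declares Verdict.alt) :=
        measure_mono_ae (hae.mono fun ω hω _ => hω)
    _ ≤ _ := measure_union_le _ _

end DecisionRule

theorem sum_logRatio_le_of_measuredRelEntropy {ρ σ : stateSpace d} (hσ : σ.1.PosDef) {c : ℝ}
    (hc : 0 ≤ c) (h : measuredRelEntropy ρ σ ≤ ENNReal.ofReal c) (M : POVM d m) :
    ∑ x, bornProb ρ M x * logRatio ρ σ (M, x) ≤ c := by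
  have h₁ := (le_iSup₂ (f := fun (m : ℕ) (M : POVM d m) =>
    InformationTheory.klDiv (bornMeasure ρ M) (bornMeasure σ M)) m M).trans h
  rwa [klDiv_bornMeasure ρ hσ, ENNReal.ofReal_le_ofReal_iff hc] at h₁

/-- The exponent of the error of announcing `v` under `σ` is at most `D_M(ρ‖σ)` if `v` is the
likely verdict under `ρ` and the expected number of copies under `ρ` is about `n`. -/
theorem exponent_le_measuredRelEntropy {S : ℕ → Test d} {ρ σ : stateSpace d}
    (hρ : ρ.1.PosDef) (hσ : σ.1.PosDef) {v v' : Verdict} (hv : v ≠ Verdict.continue)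
    {e e' : ℕ → ℝ≥0∞} {R : ℝ}
    (hvv : ∀ n, (S n).expectedTime ρ ≠ ∞ → 1 ≤ (S n).strategy.law ρ ((S n).decision.declares v) +
      (S n).strategy.law ρ ((S n).decision.declares v'))
    (he : ∀ n, (S n).strategy.law σ ((S n).decision.declares v) ≤ e n)
    (he' : ∀ n, (S n).strategy.law ρ ((S n).decision.declares v') ≤ e' n)
    (he'0 : Tendsto e' atTop (𝓝 0))
    (hR : (R : EReal) ≤ liminf (fun n : ℕ => ((1 / n : ℝ) : EReal) * ENNReal.log (e n)⁻¹) atTop)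
    (hT : ∀ᶠ n : ℕ in atTop, (S n).expectedTime ρ ≤ ENNReal.ofReal (n + 1)) :
    (R : EReal) ≤ (measuredRelEntropy ρ σ : EReal) := by
  by_contra! hlt
  have hfin : measuredRelEntropy ρ σ ≠ ∞ := by
    rintro h; rw [h] at hlt; simp at hlt
  set c := (measuredRelEntropy ρ σ).toReal with hc_def
  have hc : 0 ≤ c := ENNReal.toReal_nonneg
  have hc' : measuredRelEntropy ρ σ = ENNReal.ofReal c := (ENNReal.ofReal_toReal hfin).symm
  have hcR : c < R := by
    rw [hc', EReal.coe_ennreal_ofReal, max_eq_left hc] at hlt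
    exact_mod_cast hlt
  obtain ⟨R', hcR', hR'R⟩ := exists_between hcR
  have hR'0 : 0 < R' := hc.trans_lt hcR'
  obtain ⟨ε, hε0, hε⟩ : ∃ ε : ℝ, 0 < ε ∧ c < R' * (1 - ε) := by
    -- This ε makes `R' * (1 - ε)` the midpoint of `c` and `R'`.
    refine ⟨(R' - c) / (2 * R'), div_pos (by linarith) (by linarith), ?_⟩
    have : R' * (1 - (R' - c) / (2 * R')) = (R' + c) / 2 := by field_simp; ring
    rw [this]; linarith
  have h₁ := eventually_lt_of_lt_liminf ((EReal.coe_lt_coe_iff.2 hR'R).trans_le hR)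
  have h₂ : ∀ᶠ n in atTop, e' n < ENNReal.ofReal ε :=
    he'0.eventually_lt_const (ENNReal.ofReal_pos.2 hε0)
  have h₃ : ∀ᶠ n : ℕ in atTop, c + 1 < n * (R' * (1 - ε) - c) :=
    (tendsto_natCast_atTop_atTop.atTop_mul_const (sub_pos.2 hε)).eventually_gt_atTop (c + 1)
  obtain ⟨n, h₁, h₂, h₃, hT, hn⟩ :=
    (h₁.and (h₂.and (h₃.and (hT.and (eventually_ne_atTop 0))))).exists
  have hen := (coe_le_rate_iff hn R' (e n)).1 h₁.le
  -- With a = n R', the term e^a P_σ(A) is at most 1, while P_ρ(A) ≥ 1 − ε and E_ρ T ≤ n + 1. So n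
  -- R' (1 − ε) ≤ c (n + 1) + 1, against the choice of `n` in `h₃`.
  have key := mul_law_declares_le (S n).strategy (S n).decision hρ hσ hv
    (a := n * R') (c := c) (by positivity) hc
    fun M => sum_logRatio_le_of_measuredRelEntropy hσ hc hc'.le M
  have hTn : (S n).expectedTime ρ ≠ ∞ := ne_top_of_le_ne_top ENNReal.ofReal_ne_top hT
  set p := ((S n).strategy.law ρ).real ((S n).decision.declares v)
  have hp : (S n).strategy.law ρ ((S n).decision.declares v) = ENNReal.ofReal p :=
    (ofReal_measureReal (measure_ne_top _ _)).symm
  have hp0 : 0 ≤ p := measureReal_nonneg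
  have hp1 : 1 - ε ≤ p := by
    have h := (hvv n hTn).trans (add_le_add le_rfl ((he' n).trans h₂.le))
    rw [hp, ← ENNReal.ofReal_add hp0 hε0.le, ENNReal.one_le_ofReal] at h
    linarith
  have hfinal : n * R' * p ≤ c * (n + 1) + 1 := by
    rw [← ENNReal.ofReal_le_ofReal_iff (by positivity),
      ENNReal.ofReal_mul (by positivity), ← hp]
    refine key.trans ?_
    rw [ENNReal.ofReal_add (by positivity) zero_le_one, ENNReal.ofReal_mul hc]
    refine add_le_add (mul_le_mul_right hT _) ?_
    calc _ ≤ ENNReal.ofReal (Real.exp (n * R')) * ENNReal.ofReal (Real.exp (-(n * R'))) :=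
          mul_le_mul_right ((he n).trans hen) _
      _ = _ := by rw [← ENNReal.ofReal_mul (Real.exp_pos _).le, ← Real.exp_add, add_neg_cancel,
          Real.exp_zero]
  have : n * R' * (1 - ε) ≤ n * R' * p := by gcongr
  linarith

theorem coe_le_coe_ennreal_iff (r : ℝ) (x : ℝ≥0∞) :
    (r : EReal) ≤ (x : EReal) ↔ ENNReal.ofReal r ≤ x := by
  rw [← EReal.coe_ennreal_le_coe_ennreal_iff, EReal.coe_ennreal_ofReal]
  rcases le_total r 0 with h | h
  · rw [max_eq_right h, EReal.coe_zero]
    exact iff_of_true ((EReal.coe_nonpos.2 h).trans (EReal.coe_ennreal_nonneg x))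
      (EReal.coe_ennreal_nonneg x)
  · rw [max_eq_left h]

/-- Both coordinates are instances of `exponent_le_measuredRelEntropy`: for `R.1` the verdict `alt`
is likely under each σ in `D` and rare under ρ, for `R.2` the verdict `null` is likely under ρ and
rare under each σ. -/
theorem Achieves.mem_entropyRectangle {ρ : stateSpace d} (hρ : ρ.1 ∈ fullRankStates d)
    {D : Set (Matrix (Fin d) (Fin d) ℂ)} (hD : D ⊆ fullRankStates d) {S : ℕ → Test d} {R : ℝ × ℝ}
    (h₀ : 0 ≤ R.1) (h₁ : 0 ≤ R.2) (h : Achieves ρ D S R) : R ∈ entropyRectangle ρ D := by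
  obtain ⟨hα, hβ, hR₀, hR₁, hT⟩ := h
  have hT' : ∀ᶠ n : ℕ in atTop, (S n).worstExpectedTime ρ D ≤ ENNReal.ofReal (n + 1) := by
    filter_upwards [eventually_lt_of_limsup_lt (hT.trans_lt zero_lt_one)] with n hn
    have h := EReal.sub_lt_iff (Or.inl (EReal.coe_ne_bot _)) (Or.inl (EReal.coe_ne_top _)) |>.1 hn
    rw [← EReal.coe_ennreal_le_coe_ennreal_iff, EReal.coe_ennreal_ofReal,
      max_eq_left (by positivity), add_comm, EReal.coe_add]
    exact h.le
  have hi : ∀ {f : stateSpace d → ℝ≥0∞} {r : ℝ},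
      (∀ σ : stateSpace d, σ.1 ∈ D → (r : EReal) ≤ (f σ : EReal)) →
      (r : EReal) ≤ ((⨅ (σ : stateSpace d) (_ : σ.1 ∈ D), f σ : ℝ≥0∞) : EReal) := by
    intro f r h
    rw [coe_le_coe_ennreal_iff]
    exact le_iInf₂ fun σ hσ => (coe_le_coe_ennreal_iff _ _).1 (h σ hσ)
  refine ⟨h₀, h₁, hi fun σ hσ => ?_, hi fun σ hσ => ?_⟩
  · refine exponent_le_measuredRelEntropy (S := S) (hD hσ).1 hρ.1 (v := Verdict.alt)
      (v' := Verdict.null) (by simp) (fun n hn => ?_) (fun n => le_rfl) (fun n => ?_) hβ hR₀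
      (hT'.mono fun n hn => ?_)
    · rw [add_comm]
      exact (S n).decision.one_le_declares_add _ hn
    · exact le_iSup₂ (f := fun (σ : stateSpace d) (_ : σ.1 ∈ D) =>
        (S n).strategy.law σ ((S n).decision.declares Verdict.null)) σ hσ
    · exact ((le_iSup₂ (f := fun (σ : stateSpace d) (_ : σ.1 ∈ D) =>
        (S n).expectedTime σ) σ hσ).trans (le_max_right _ _)).trans hn
  · refine exponent_le_measuredRelEntropy (S := S) hρ.1 (hD hσ).1 (v := Verdict.null)
      (v' := Verdict.alt) (by simp) (fun n hn => ?_) (fun n => ?_) (fun n => le_rfl) hα hR₁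
      (hT'.mono fun n hn => ?_)
    · exact (S n).decision.one_le_declares_add _ hn
    · exact le_iSup₂ (f := fun (σ : stateSpace d) (_ : σ.1 ∈ D) =>
        (S n).strategy.law σ ((S n).decision.declares Verdict.null)) σ hσ
    · exact (le_max_left _ _).trans hn

theorem isClosed_entropyRectangle (ρ : stateSpace d) (D : Set (Matrix (Fin d) (Fin d) ℂ)) :
    IsClosed (entropyRectangle ρ D) := by
  have h₁ : Continuous fun R : ℝ × ℝ => (R.1 : EReal) :=
    continuous_coe_real_ereal.comp continuous_fst
  have h₂ : Continuous fun R : ℝ × ℝ => (R.2 : EReal) :=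
    continuous_coe_real_ereal.comp continuous_snd
  exact (isClosed_le continuous_const continuous_fst).and
    ((isClosed_le continuous_const continuous_snd).and
      ((isClosed_le h₁ continuous_const).and (isClosed_le h₂ continuous_const)))

/-! ### A minimax theorem -/

/-- If every point of a compact convex set is mapped above `r` by some functional of a convex set,
then one functional of that set maps all points above `r`. -/
theorem exists_forall_lt_of_forall_exists_lt {V : Type*} [AddCommGroup V] [Module ℝ V]
    [TopologicalSpace V] {D : Set V} (hD : IsCompact D) (hDc : Convex ℝ D) (hDne : D.Nonempty)
    {C : Set (V →ₗ[ℝ] ℝ)} (hC : Convex ℝ C) (hcont : ∀ L ∈ C, Continuous L) {r : ℝ}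
    (h : ∀ a ∈ D, ∃ L ∈ C, r < L a) : ∃ L ∈ C, ∀ a ∈ D, r < L a := by
  classical
  -- By compactness finitely many functionals suffice. They map `D` to a compact convex set in a
  -- finite-dimensional space that misses the orthant of vectors with all coordinates at most `r`; a
  -- separating hyperplane supplies the weights of the desired combination.
  obtain ⟨t, ht⟩ := hD.elim_finite_subcover (fun L : C => {a | r < L.1 a})
    (fun L => isOpen_lt continuous_const (hcont L L.2))
    (fun a ha => by
      obtain ⟨L, hL, hr⟩ := h a ha
      exact Set.mem_iUnion.2 ⟨⟨L, hL⟩, hr⟩)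
  let Φ : V →ₗ[ℝ] (t → ℝ) := LinearMap.pi fun L => L.1.1
  have hΦ : Continuous Φ := continuous_pi fun L => hcont L.1.1 L.1.2
  obtain ⟨f, u, v, hu, huv, hv⟩ := geometric_hahn_banach_closed_compact
    (s := {y : t → ℝ | ∀ i, y i ≤ r}) (t := Φ '' D)
    (by
      have : {y : t → ℝ | ∀ i, y i ≤ r} = Set.Iic fun _ => r := by ext; rfl
      rw [this]; exact convex_Iic _)
    (by
      have : {y : t → ℝ | ∀ i, y i ≤ r} = Set.Iic fun _ => r := by ext; rfl
      rw [this]; exact isClosed_Iic)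
    (hDc.linear_image Φ) (hD.image hΦ)
    (by
      refine Set.disjoint_left.2 ?_
      rintro _ hy ⟨a, ha, rfl⟩
      obtain ⟨L, hLt, hL⟩ := Set.mem_iUnion₂.1 (ht ha)
      exact absurd (hy ⟨L, hLt⟩) (not_le.2 hL))
  set w : t → ℝ := fun i => f (Pi.single i 1) with hw_def
  have hf : ∀ y : t → ℝ, f y = ∑ i, y i * w i := fun y => by
    conv_lhs => rw [← Finset.univ_sum_single y]
    rw [map_sum]
    refine Finset.sum_congr rfl fun i _ => ?_
    have : (Pi.single i (y i) : t → ℝ) = y i • Pi.single i 1 := by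
      rw [← Pi.single_smul, smul_eq_mul, mul_one]
    rw [this, map_smul, smul_eq_mul]
  have hconst : f (fun _ => r) < u := hu _ fun _ => le_rfl
  have hw : ∀ i, 0 ≤ w i := by
    intro i
    by_contra! hi
    -- If `w i` were negative, lowering coordinate `i` by this `s` would stay in the orthant and
    -- raise `f` exactly to `u`.
    set s : ℝ := (u - f (fun _ => r)) / (-w i)
    have hs : 0 ≤ s := div_nonneg (by linarith) (by linarith)
    have h₁ := hu ((fun _ => r) - s • Pi.single i 1) fun j => by
      have : 0 ≤ s * (Pi.single i 1 : t → ℝ) j := by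
        refine mul_nonneg hs ?_
        by_cases hij : j = i
        · subst hij; simp
        · simp [hij]
      simpa using this
    rw [map_sub, map_smul, smul_eq_mul] at h₁
    have h₂ : s * w i = -(u - f (fun _ => r)) := by
      simp only [s]
      rw [div_neg, neg_mul, div_mul_cancel₀ _ hi.ne]
    change f (fun _ => r) - s * w i < u at h₁
    linarith
  set W := ∑ i, w i with hW_def
  have hrW : r * W < u := by
    rwa [hf, ← Finset.mul_sum] at hconst
  have hva : ∀ a ∈ D, v < ∑ i, Φ a i * w i := fun a ha => by
    rw [← hf]; exact hv _ ⟨a, ha, rfl⟩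
  -- If all weights vanished, then f = 0, which contradicts 0 < u < v < 0.
  have hW : 0 < W := by
    refine lt_of_le_of_ne (Finset.sum_nonneg fun i _ => hw i) fun h0 => ?_
    have hz := (Finset.sum_eq_zero_iff_of_nonneg fun i _ => hw i).1 h0.symm
    obtain ⟨a, ha⟩ := hDne
    have := hva a ha
    rw [Finset.sum_eq_zero fun i hi => by rw [hz i hi, mul_zero]] at this
    rw [← h0, mul_zero] at hrW
    linarith
  refine ⟨∑ i, (w i / W) • i.1.1, ?_, fun a ha => ?_⟩
  · refine hC.sum_mem (fun i _ => div_nonneg (hw i) hW.le) ?_ fun i _ => i.1.2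
    rw [← Finset.sum_div, div_self hW.ne']
  · have : (∑ i, (w i / W) • i.1.1) a = (∑ i, Φ a i * w i) / W := by
      rw [LinearMap.sum_apply, Finset.sum_div]
      refine Finset.sum_congr rfl fun i _ => ?_
      simp only [LinearMap.smul_apply, smul_eq_mul, Φ, LinearMap.pi_apply]
      ring
    rw [this, lt_div_iff₀ hW]
    linarith [hva a ha]

/-! ### Mixtures of measurements -/

/-- The expectation of a function of the outcome of `M`, as a real-linear functional of the
state. -/
noncomputable def outcomeFunctional (M : POVM d m) (f : Fin m → ℝ) :
    Matrix (Fin d) (Fin d) ℂ →ₗ[ℝ] ℝ :=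
  ∑ x, f x • (Complex.reLm ∘ₗ (Matrix.traceLinearMap (Fin d) ℝ ℂ) ∘ₗ LinearMap.mulLeft ℝ (M.1 x))

theorem outcomeFunctional_apply (M : POVM d m) (f : Fin m → ℝ) (ρ : stateSpace d) :
    outcomeFunctional M f ρ.1 = ∑ x, bornProb ρ M x * f x := by
  simp only [outcomeFunctional, LinearMap.sum_apply, LinearMap.smul_apply, smul_eq_mul, bornProb]
  exact Finset.sum_congr rfl fun x _ => mul_comm _ _

theorem continuous_outcomeFunctional (M : POVM d m) (f : Fin m → ℝ) :
    Continuous (outcomeFunctional M f) :=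
  LinearMap.continuous_of_finiteDimensional _

/-- The POVM that applies `M` with probability `t` and `M'` otherwise, and records which one was
applied. -/
noncomputable def POVM.mix (t : ℝ) (h₀ : 0 ≤ t) (h₁ : t ≤ 1) (M : POVM d m) (M' : POVM d m') :
    POVM d (m + m') :=
  ⟨Fin.append (fun x => t • M.1 x) (fun x => (1 - t) • M'.1 x), by
    refine ⟨fun x => ?_, ?_⟩
    · refine Fin.addCases (fun i => ?_) (fun i => ?_) x
      · rw [Fin.append_left]; exact (M.2.1 i).smul h₀
      · rw [Fin.append_right]; exact (M'.2.1 i).smul (sub_nonneg.2 h₁)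
    · simp only [Fin.sum_univ_add, Fin.append_left, Fin.append_right]
      rw [← Finset.smul_sum, ← Finset.smul_sum, M.2.2, M'.2.2, ← add_smul]
      simp⟩

/-- The source of convexity in the minimax argument: since the coin is recorded in the outcome, the
statistic may be chosen separately on each block. -/
theorem outcomeFunctional_mix {t : ℝ} (h₀ : 0 ≤ t) (h₁ : t ≤ 1) (M : POVM d m) (M' : POVM d m')
    (f : Fin (m + m') → ℝ) :
    outcomeFunctional (POVM.mix t h₀ h₁ M M') f =
      t • outcomeFunctional M (fun x => f (Fin.castAdd m' x)) +
        (1 - t) • outcomeFunctional M' (fun x => f (Fin.natAdd m x)) := by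
  ext a
  simp only [outcomeFunctional, POVM.mix, Fin.sum_univ_add, Fin.append_left, Fin.append_right,
    LinearMap.add_apply, LinearMap.sum_apply, LinearMap.smul_apply, LinearMap.comp_apply,
    LinearMap.mulLeft_apply, Matrix.traceLinearMap_apply, Complex.reLm_coe, smul_eq_mul,
    Finset.mul_sum, Matrix.smul_mul, Matrix.trace_smul, Complex.real_smul, Complex.re_ofReal_mul]
  congr 1 <;> exact Finset.sum_congr rfl fun x _ => by ring

/-! ### E-variables from measured relative entropies -/

/-- The likelihood ratio is an e-variable under ρ. The inequality can be strict only at outcomes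
null under ρ, which may exist because ρ need not be full rank here. -/
theorem bornProb_mul_exp_logRatio_le (ρ : stateSpace d) {σ : stateSpace d} (hσ : σ.1.PosDef)
    (M : POVM d m) (x : Fin m) :
    bornProb ρ M x * Real.exp (logRatio σ ρ (M, x)) ≤ bornProb σ M x := by
  have h := ofReal_bornProb_mul_exp_le (ρ := ρ) hσ M x
  rwa [← logRatio_symm, ← ENNReal.ofReal_mul (bornProb_nonneg ρ M x),
    ENNReal.ofReal_le_ofReal_iff (bornProb_nonneg σ M x)] at h

theorem sum_bornProb_mul_exp_logRatio_le (ρ : stateSpace d) {σ : stateSpace d} (hσ : σ.1.PosDef)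
    (M : POVM d m) : ∑ x, bornProb ρ M x * Real.exp (logRatio σ ρ (M, x)) ≤ 1 :=
  (Finset.sum_le_sum fun x _ => bornProb_mul_exp_logRatio_le ρ hσ M x).trans_eq (sum_bornProb σ M)

/-- Gibbs' variational bound for the measured relative entropy. -/
theorem ofReal_sum_le_measuredRelEntropy (ρ : stateSpace d) {σ : stateSpace d} (hσ : σ.1.PosDef)
    (M : POVM d m) {f : Fin m → ℝ} (hf : ∑ x, bornProb σ M x * Real.exp (f x) ≤ 1) :
    ENNReal.ofReal (∑ x, bornProb ρ M x * f x) ≤ measuredRelEntropy ρ σ := by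
  refine le_trans ?_ (le_iSup₂ (f := fun (m : ℕ) (M : POVM d m) =>
    InformationTheory.klDiv (bornMeasure ρ M) (bornMeasure σ M)) m M)
  rw [klDiv_bornMeasure ρ hσ]
  refine ENNReal.ofReal_le_ofReal ?_
  -- Pointwise 1 + u ≤ e^u with u = f − `logRatio ρ σ`; summation over the outcomes gives the bound.
  have key : ∀ x, bornProb ρ M x * f x - bornProb ρ M x * logRatio ρ σ (M, x) ≤
      bornProb σ M x * Real.exp (f x) - bornProb ρ M x := by
    intro x
    rcases eq_or_lt_of_le (bornProb_nonneg ρ M x) with h | h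
    · rw [← h]
      have := mul_nonneg (bornProb_nonneg σ M x) (Real.exp_pos (f x)).le
      linarith
    have h' : 0 < bornProb σ M x :=
      lt_of_le_of_ne (bornProb_nonneg σ M x) fun h0 => h.ne' (bornProb_eq_zero hσ ρ h0.symm)
    have e : bornProb σ M x * Real.exp (f x) =
        bornProb ρ M x * Real.exp (f x - logRatio ρ σ (M, x)) := by
      rw [Real.exp_sub, logRatio, Real.exp_log (by positivity)]
      field_simp
    rw [e]
    have := mul_le_mul_of_nonneg_left (Real.add_one_le_exp (f x - logRatio ρ σ (M, x))) h.le
    linarith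
  have := Finset.sum_le_sum fun x (_ : x ∈ Finset.univ) => key x
  rw [Finset.sum_sub_distrib, Finset.sum_sub_distrib, sum_bornProb] at this
  linarith

/-- The two-outcome POVM whose first effect is proportional to H + c·1, with H = ρ − σ, separates
the states: equal outcome distributions would give tr[(H + c·1) H] = 0, hence tr H² = 0 because tr H
= 0, hence H = 0. -/
theorem measuredRelEntropy_pos {ρ σ : stateSpace d} (h : ρ ≠ σ) : 0 < measuredRelEntropy ρ σ := by
  obtain ⟨a, ha, h₁⟩ := exists_pos_smul_one_sub_posSemidef ρ.2.1.isHermitian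
  obtain ⟨b, hb, h₂⟩ := exists_pos_smul_one_sub_posSemidef σ.2.1.isHermitian
  set c := max a b
  have hc : 0 < c := lt_max_of_lt_left ha
  set A : Matrix (Fin d) (Fin d) ℂ := (2 * c)⁻¹ • (ρ.1 + (c • 1 - σ.1)) with hA
  set B : Matrix (Fin d) (Fin d) ℂ := (2 * c)⁻¹ • (σ.1 + (c • 1 - ρ.1)) with hB
  have hAB : A + B = 1 := by
    rw [hA, hB, ← smul_add]
    have : ρ.1 + (c • 1 - σ.1) + (σ.1 + (c • 1 - ρ.1)) =
        (2 * c) • (1 : Matrix (Fin d) (Fin d) ℂ) := by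
      rw [two_mul, add_smul]; abel
    rw [this, smul_smul, inv_mul_cancel₀ (by positivity), one_smul]
  have hp : (0 : ℝ) ≤ (2 * c)⁻¹ := by positivity
  let M : POVM d 2 := ⟨![A, B], by
    refine ⟨fun x => ?_, by simpa using hAB⟩
    fin_cases x
    · exact (ρ.2.1.add (h₂ c (le_max_right _ _))).smul hp
    · exact (σ.2.1.add (h₁ c (le_max_left _ _))).smul hp⟩
  refine lt_of_lt_of_le ?_ (le_iSup₂ (f := fun (m : ℕ) (M : POVM d m) =>
    InformationTheory.klDiv (bornMeasure ρ M) (bornMeasure σ M)) 2 M)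
  refine pos_iff_ne_zero.2 fun h0 => h ?_
  rw [InformationTheory.klDiv_eq_zero_iff] at h0
  have hb : bornProb ρ M 0 = bornProb σ M 0 := by
    have := congrArg (fun μ : Measure (Fin 2) => μ {0}) h0
    simp only [bornMeasure_singleton] at this
    exact (ENNReal.ofReal_eq_ofReal_iff (bornProb_nonneg _ _ _) (bornProb_nonneg _ _ _)).1 this
  set H := ρ.1 - σ.1 with hH
  have hHh : H.IsHermitian := ρ.2.1.isHermitian.sub σ.2.1.isHermitian
  have hz : (H * H).trace.re = 0 := by
    have e : A = (2 * c)⁻¹ • (H + c • 1) := by rw [hA, hH]; congr 1; abel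
    have h₃ : (A * H).trace.re = 0 := by
      rw [hH, Matrix.mul_sub, Matrix.trace_sub, Complex.sub_re, sub_eq_zero]
      exact hb
    have ht : H.trace = 0 := by rw [hH, Matrix.trace_sub, ρ.2.2, σ.2.2, sub_self]
    rw [e, Matrix.smul_mul, Matrix.add_mul, Matrix.smul_mul, Matrix.one_mul, Matrix.trace_smul,
      Matrix.trace_add, Matrix.trace_smul, ht, smul_zero, add_zero, Complex.real_smul,
      Complex.re_ofReal_mul] at h₃
    exact (mul_eq_zero.1 h₃).resolve_left (by positivity)
  have hz' : (H.conjTranspose * H).trace = 0 := by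
    have h₄ := (Matrix.posSemidef_conjTranspose_mul_self H).trace_nonneg
    rw [Complex.le_def] at h₄
    refine Complex.ext ?_ h₄.2.symm
    rw [hHh.eq]; exact hz
  exact Subtype.ext (sub_eq_zero.1 (Matrix.trace_conjTranspose_mul_self_eq_zero_iff.1 hz'))

theorem exists_lt_sum_logRatio {ρ σ : stateSpace d} (hσ : σ.1.PosDef) {r : ℝ} (hr : 0 ≤ r)
    (h : ENNReal.ofReal r < measuredRelEntropy ρ σ) :
    ∃ (m : ℕ) (M : POVM d m), r < ∑ x, bornProb ρ M x * logRatio ρ σ (M, x) := by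
  obtain ⟨m, h⟩ := lt_iSup_iff.1 h
  obtain ⟨M, h⟩ := lt_iSup_iff.1 h
  rw [klDiv_bornMeasure ρ hσ] at h
  exact ⟨m, M, (ENNReal.ofReal_lt_ofReal_iff_of_nonneg hr).1 h⟩

section

variable {ρ : stateSpace d} (hρ : ρ.1.PosDef) {D : Set (Matrix (Fin d) (Fin d) ℂ)}
  (hD : D ⊆ fullRankStates d) (hcompact : IsCompact D) (hconvex : Convex ℝ D)
  (hne : D.Nonempty) {r : ℝ} (hr : 0 ≤ r)

include hρ hD hcompact hconvex hne hr in
/-- A single measurement and e-variable against all of `D` with growth rate above `r` under `ρ`. -/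
theorem exists_evariable_composite_null
    (h : ∀ σ : stateSpace d, σ.1 ∈ D → ENNReal.ofReal r < measuredRelEntropy ρ σ) :
    ∃ (m : ℕ) (M : POVM d m) (f : Fin m → ℝ), r < ∑ x, bornProb ρ M x * f x ∧
      ∀ σ : stateSpace d, σ.1 ∈ D → ∑ x, bornProb σ M x * Real.exp (f x) ≤ 1 := by
  -- The growth condition under ρ is built into the set, and the e-variable condition on σ becomes
  -- the level −1 of the functional. Both are affine under mixing.
  let C : Set (Matrix (Fin d) (Fin d) ℂ →ₗ[ℝ] ℝ) := {L | ∃ (m : ℕ) (M : POVM d m) (f : Fin m → ℝ),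
    r < outcomeFunctional M f ρ.1 ∧ L = -outcomeFunctional M fun x => Real.exp (f x)}
  have hC : Convex ℝ C := by
    rintro _ ⟨m, M, f, hf, rfl⟩ _ ⟨m', M', f', hf', rfl⟩ a b ha hb hab
    obtain rfl : b = 1 - a := by linarith
    refine ⟨m + m', POVM.mix a ha (by linarith) M M', Fin.append f f', ?_, ?_⟩
    · simp only [outcomeFunctional_mix, Fin.append_left, Fin.append_right, LinearMap.add_apply,
        LinearMap.smul_apply, smul_eq_mul]
      have := convex_Ioi r hf hf' ha hb hab
      simpa using this
    · simp only [outcomeFunctional_mix, Fin.append_left, Fin.append_right, smul_neg, neg_add_rev]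
      abel
  obtain ⟨L, ⟨m, M, f, hf, rfl⟩, hL⟩ := exists_forall_lt_of_forall_exists_lt hcompact hconvex hne hC
    (r := -1) (by
      rintro _ ⟨m, M, f, -, rfl⟩
      exact (continuous_outcomeFunctional M _).neg) (by
      intro a ha
      set σ : stateSpace d := ⟨a, (hD ha).1.posSemidef, (hD ha).2⟩
      have hσ : σ.1.PosDef := (hD ha).1
      obtain ⟨m, M, hM⟩ := exists_lt_sum_logRatio hσ hr (h σ ha)
      set k := ∑ x, bornProb ρ M x * logRatio ρ σ (M, x)
      -- Lowering the log-ratio by half the excess keeps the growth rate above `r`, at (k + r)/2,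
      -- and makes the e-variable inequality strict, as the minimax lemma requires.
      refine ⟨_, ⟨m, M, fun x => logRatio ρ σ (M, x) - (k - r) / 2, ?_, rfl⟩, ?_⟩
      · rw [outcomeFunctional_apply]
        simp only [mul_sub, Finset.sum_sub_distrib, ← Finset.sum_mul, sum_bornProb]
        linarith
      · rw [LinearMap.neg_apply, neg_lt_neg_iff]
        change outcomeFunctional M _ σ.1 < 1
        rw [outcomeFunctional_apply]
        simp only [Real.exp_sub, mul_div_assoc', ← Finset.sum_div]
        rw [div_lt_one (Real.exp_pos _)]
        have h₁ := sum_bornProb_mul_exp_logRatio_le σ hρ M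
        exact h₁.trans_lt (Real.one_lt_exp_iff.2 (by linarith)))
  refine ⟨m, M, f, by rwa [outcomeFunctional_apply] at hf, fun σ hσ => ?_⟩
  have := hL σ.1 hσ
  rw [LinearMap.neg_apply, neg_lt_neg_iff, outcomeFunctional_apply] at this
  exact this.le

include hρ hD hcompact hconvex hne hr in
/-- A single measurement and e-variable against `ρ` with growth rate above `r` on all of `D`. -/
theorem exists_evariable_composite_alt
    (h : ∀ σ : stateSpace d, σ.1 ∈ D → ENNReal.ofReal r < measuredRelEntropy σ ρ) :
    ∃ (m : ℕ) (M : POVM d m) (f : Fin m → ℝ), ∑ x, bornProb ρ M x * Real.exp (f x) ≤ 1 ∧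
      ∀ σ : stateSpace d, σ.1 ∈ D → r < ∑ x, bornProb σ M x * f x := by
  -- The roles are exchanged: the e-variable condition under the fixed state ρ defines the set, and
  -- the growth rate is the functional.
  let C : Set (Matrix (Fin d) (Fin d) ℂ →ₗ[ℝ] ℝ) := {L | ∃ (m : ℕ) (M : POVM d m) (f : Fin m → ℝ),
    outcomeFunctional M (fun x => Real.exp (f x)) ρ.1 ≤ 1 ∧ L = outcomeFunctional M f}
  have hC : Convex ℝ C := by
    rintro _ ⟨m, M, f, hf, rfl⟩ _ ⟨m', M', f', hf', rfl⟩ a b ha hb hab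
    obtain rfl : b = 1 - a := by linarith
    refine ⟨m + m', POVM.mix a ha (by linarith) M M', Fin.append f f', ?_, ?_⟩
    · simp only [outcomeFunctional_mix, Fin.append_left, Fin.append_right, LinearMap.add_apply,
        LinearMap.smul_apply, smul_eq_mul]
      have := convex_Iic (1 : ℝ) hf hf' ha hb hab
      simpa using this
    · simp only [outcomeFunctional_mix, Fin.append_left, Fin.append_right]
  obtain ⟨L, ⟨m, M, f, hf, rfl⟩, hL⟩ := exists_forall_lt_of_forall_exists_lt hcompact hconvex hne hC
    (r := r) (by
      rintro _ ⟨m, M, f, -, rfl⟩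
      exact continuous_outcomeFunctional M _) (by
      intro a ha
      set σ : stateSpace d := ⟨a, (hD ha).1.posSemidef, (hD ha).2⟩
      obtain ⟨m, M, hM⟩ := exists_lt_sum_logRatio hρ hr (h σ ha)
      refine ⟨_, ⟨m, M, fun x => logRatio σ ρ (M, x), ?_, rfl⟩, ?_⟩
      · rw [outcomeFunctional_apply]
        exact sum_bornProb_mul_exp_logRatio_le ρ (hD ha).1 M
      · change _ < outcomeFunctional M _ σ.1
        rwa [outcomeFunctional_apply])
  rw [outcomeFunctional_apply] at hf
  refine ⟨m, M, f, hf, fun σ hσ => ?_⟩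
  have := hL σ.1 hσ
  rwa [outcomeFunctional_apply] at this

end

/-! ### A pair of measurements for the adaptive test -/

/-- Jensen's inequality in the form 1 + f ≤ e^f. It is strict because the positive mean under σ
yields an outcome with f ≠ 0 of positive probability under σ, hence also under ρ. So evidence
against a hypothesis decreases on average when the hypothesis is true. -/
theorem sum_bornProb_mul_neg {ρ : stateSpace d} (hρ : ρ.1.PosDef) (σ : stateSpace d)
    {M : POVM d m} {f : Fin m → ℝ} (h : ∑ x, bornProb ρ M x * Real.exp (f x) ≤ 1)
    (hσ : 0 < ∑ x, bornProb σ M x * f x) : ∑ x, bornProb ρ M x * f x < 0 := by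
  obtain ⟨y, -, hy⟩ := Finset.exists_ne_zero_of_sum_ne_zero hσ.ne'
  have hy0 : 0 < bornProb ρ M y := lt_of_le_of_ne (bornProb_nonneg ρ M y) fun h0 =>
    hy (by rw [bornProb_eq_zero hρ σ h0.symm, zero_mul])
  have hlt : ∑ x, bornProb ρ M x * (f x + 1) < ∑ x, bornProb ρ M x * Real.exp (f x) := by
    refine Finset.sum_lt_sum (fun x _ => mul_le_mul_of_nonneg_left (Real.add_one_le_exp _)
      (bornProb_nonneg ρ M x)) ⟨y, Finset.mem_univ y, ?_⟩
    exact mul_lt_mul_of_pos_left (Real.add_one_lt_exp (right_ne_zero_of_mul hy)) hy0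
  simp only [mul_add, mul_one, Finset.sum_add_distrib, sum_bornProb] at hlt
  linarith

/-- Bounded functions of negative mean have uniformly contracting exponential moments. -/
theorem exists_exp_moment_lt_one (d : ℕ) {B κ : ℝ} (hB : 0 < B) (hκ : 0 < κ) :
    ∃ q lam : ℝ, 0 < q ∧ 0 ≤ lam ∧ lam < 1 ∧ ∀ {m : ℕ} (M : POVM d m) (ρ : stateSpace d)
      (h : Fin m → ℝ), (∀ x, |h x| ≤ B) → ∑ x, bornProb ρ M x * h x ≤ -κ →
        ∑ x, bornProb ρ M x * Real.exp (q * h x) ≤ lam := by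
  -- The bound `q * B ≤ 1` permits e^u ≤ 1 + u + u², and `q * B ^ 2 ≤ κ / 2` lets the quadratic term
  -- consume at most half of the drift, which leaves 1 − qκ/2.
  set q := min (1 / B) (κ / (2 * B ^ 2)) with hq_def
  have hq : 0 < q := by positivity
  have hq₁ : q * B ≤ 1 := by rw [← le_div_iff₀ hB]; exact min_le_left _ _
  have hq₂ : q * B ^ 2 ≤ κ / 2 := by
    have : q ≤ κ / (2 * B ^ 2) := min_le_right _ _
    rw [le_div_iff₀ (by positivity)] at this
    linarith
  refine ⟨q, max 0 (1 - q * κ / 2), hq, le_max_left _ _, max_lt one_pos (by nlinarith), ?_⟩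
  intro m M ρ h hh hκh
  refine le_trans ?_ (le_max_right _ _)
  have hpt : ∀ x, bornProb ρ M x * Real.exp (q * h x) ≤
      bornProb ρ M x * (1 + q * h x + q * (κ / 2)) := by
    intro x
    refine mul_le_mul_of_nonneg_left ?_ (bornProb_nonneg ρ M x)
    have h₁ : |q * h x| ≤ 1 := by
      rw [abs_mul, abs_of_pos hq]
      exact (mul_le_mul_of_nonneg_left (hh x) hq.le).trans hq₁
    have h₂ := (abs_le.1 (Real.abs_exp_sub_one_sub_id_le h₁)).2
    have h₃ : (q * h x) ^ 2 ≤ q * (κ / 2) := by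
      have : (h x) ^ 2 ≤ B ^ 2 := sq_le_sq' (by linarith [(abs_le.1 (hh x)).1]) (abs_le.1 (hh x)).2
      calc (q * h x) ^ 2 = q * (q * (h x) ^ 2) := by ring
        _ ≤ q * (q * B ^ 2) := by gcongr
        _ ≤ q * (κ / 2) := by gcongr
    linarith
  refine (Finset.sum_le_sum fun x _ => hpt x).trans ?_
  have e : ∑ x, bornProb ρ M x * (1 + q * h x + q * (κ / 2)) =
      1 + q * ∑ x, bornProb ρ M x * h x + q * (κ / 2) := by
    simp only [mul_add, mul_one, Finset.sum_add_distrib, sum_bornProb, ← Finset.sum_mul, one_mul]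
    rw [Finset.mul_sum]
    congr 2
    exact Finset.sum_congr rfl fun x _ => by ring
  rw [e]
  have := mul_le_mul_of_nonneg_left hκh hq.le
  linarith

/-- The statistic `s` grows at rate `r` under `ρ` if `M` is measured, it does not decrease if `M'`
is measured, `s'` is an e-variable under `ρ`, and `s - s'` has an upward drift. -/
structure Favours (ρ : stateSpace d) (M M' : POVM d m) (s s' : Fin m → ℝ) (q lam r : ℝ) :
    Prop where
  rate_le : r ≤ ∑ x, bornProb ρ M x * s x
  nonneg : 0 ≤ ∑ x, bornProb ρ M' x * s x
  evariable : ∀ N, N = M ∨ N = M' → ∑ x, bornProb ρ N x * Real.exp (s' x) ≤ 1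
  drift : ∀ N, N = M ∨ N = M' → ∑ x, bornProb ρ N x * Real.exp (-q * (s x - s' x)) ≤ lam

theorem sum_bornProb_mix {t : ℝ} (h₀ : 0 ≤ t) (h₁ : t ≤ 1) (M : POVM d m) (M' : POVM d m')
    (ρ : stateSpace d) (f : Fin (m + m') → ℝ) :
    ∑ x, bornProb ρ (POVM.mix t h₀ h₁ M M') x * f x =
      t * ∑ x, bornProb ρ M x * f (Fin.castAdd m' x) +
        (1 - t) * ∑ x, bornProb ρ M' x * f (Fin.natAdd m x) := by
  simp only [← outcomeFunctional_apply, outcomeFunctional_mix, LinearMap.add_apply,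
    LinearMap.smul_apply, smul_eq_mul]

/-- Both measurements are put on one outcome set, and each statistic is extended by 0 to the other
block. Then `s₁ - s₀` equals f₁ when the first is measured and −f₀ when the second is. Under ρ both
have positive mean, by growth and by `sum_bornProb_mul_neg` respectively; under each σ in `D` both
have negative mean. -/
theorem exists_favours {ρ : stateSpace d} (hρ : ρ.1.PosDef) {D : Set (Matrix (Fin d) (Fin d) ℂ)}
    (hD : D ⊆ fullRankStates d) (hcompact : IsCompact D) (hconvex : Convex ℝ D)
    (hne : D.Nonempty) {r₀ r₁ : ℝ} (hr₀ : 0 < r₀) (hr₁ : 0 < r₁)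
    (h₀ : ∀ σ : stateSpace d, σ.1 ∈ D → ENNReal.ofReal r₀ < measuredRelEntropy σ ρ)
    (h₁ : ∀ σ : stateSpace d, σ.1 ∈ D → ENNReal.ofReal r₁ < measuredRelEntropy ρ σ) :
    ∃ (m : ℕ) (M₁ M₀ : POVM d m) (s₁ s₀ : Fin m → ℝ) (q lam : ℝ), 0 < q ∧ 0 ≤ lam ∧ lam < 1 ∧
      Favours ρ M₁ M₀ s₁ s₀ q lam r₁ ∧
      ∀ σ : stateSpace d, σ.1 ∈ D → Favours σ M₀ M₁ s₀ s₁ q lam r₀ := by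
  obtain ⟨m₁, N₁, f₁, hf₁, hf₁D⟩ :=
    exists_evariable_composite_null hρ hD hcompact hconvex hne hr₁.le h₁
  obtain ⟨m₀, N₀, f₀, hf₀, hf₀D⟩ :=
    exists_evariable_composite_alt hρ hD hcompact hconvex hne hr₀.le h₀
  -- The maximiser over the compact set `D` makes the negative drift of f₁ uniform in σ.
  obtain ⟨a, ha, hamax⟩ := hcompact.exists_isMaxOn hne
    (continuous_outcomeFunctional N₁ f₁).continuousOn
  have hst : ∀ {a} (_ : a ∈ D), ∃ σ : stateSpace d, σ.1 = a ∧ σ.1.PosDef := fun {a} ha =>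
    ⟨⟨a, (hD ha).1.posSemidef, (hD ha).2⟩, rfl, (hD ha).1⟩
  obtain ⟨τ, rfl, hτ⟩ := hst ha
  have hκ₁ := sum_bornProb_mul_neg hτ ρ (hf₁D τ ha) (hr₁.trans hf₁)
  have hκ₀ := sum_bornProb_mul_neg hρ τ hf₀ (hr₀.trans (hf₀D τ ha))
  set κ := min (min r₀ r₁) (min (-∑ x, bornProb τ N₁ x * f₁ x) (-∑ x, bornProb ρ N₀ x * f₀ x))
    with hκ_def
  have hκ : 0 < κ := lt_min (lt_min hr₀ hr₁) (lt_min (by linarith) (by linarith))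
  have hκr₀ : κ ≤ r₀ := (min_le_left _ _).trans (min_le_left _ _)
  have hκr₁ : κ ≤ r₁ := (min_le_left _ _).trans (min_le_right _ _)
  have hκτ : κ ≤ -∑ x, bornProb τ N₁ x * f₁ x := (min_le_right _ _).trans (min_le_left _ _)
  have hκρ : κ ≤ -∑ x, bornProb ρ N₀ x * f₀ x := (min_le_right _ _).trans (min_le_right _ _)
  have hκD : ∀ σ : stateSpace d, σ.1 ∈ D → ∑ x, bornProb σ N₁ x * f₁ x ≤ -κ := fun σ hσ => by
    have := isMaxOn_iff.1 hamax σ.1 hσ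
    rw [outcomeFunctional_apply, outcomeFunctional_apply] at this
    linarith
  set s₁ : Fin (m₁ + m₀) → ℝ := Fin.append f₁ 0 with hs₁
  set s₀ : Fin (m₁ + m₀) → ℝ := Fin.append 0 f₀ with hs₀
  obtain ⟨q, lam, hq, hlam, hlam1, hexp⟩ := exists_exp_moment_lt_one d
    (B := 1 + ∑ x, |s₁ x - s₀ x|) (by positivity) hκ
  have hB : ∀ x, |s₁ x - s₀ x| ≤ 1 + ∑ x, |s₁ x - s₀ x| := fun x =>
    (Finset.single_le_sum (f := fun x => |s₁ x - s₀ x|) (fun _ _ => abs_nonneg _)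
      (Finset.mem_univ x)).trans (by linarith)
  set M₁ := POVM.mix 1 zero_le_one le_rfl N₁ N₀
  set M₀ := POVM.mix 0 le_rfl zero_le_one N₁ N₀
  have e₁ : ∀ (σ : stateSpace d) (F : Fin (m₁ + m₀) → ℝ), ∑ x, bornProb σ M₁ x * F x =
      ∑ x, bornProb σ N₁ x * F (Fin.castAdd m₀ x) := fun σ F => by
    rw [sum_bornProb_mix]; ring
  have e₀ : ∀ (σ : stateSpace d) (F : Fin (m₁ + m₀) → ℝ), ∑ x, bornProb σ M₀ x * F x =
      ∑ x, bornProb σ N₀ x * F (Fin.natAdd m₁ x) := fun σ F => by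
    rw [sum_bornProb_mix]; ring
  have hdrift : ∀ {σ : stateSpace d} {s s' : Fin (m₁ + m₀) → ℝ} {N : POVM d (m₁ + m₀)},
      (∀ x, |s x - s' x| ≤ 1 + ∑ x, |s₁ x - s₀ x|) →
      κ ≤ ∑ x, bornProb σ N x * (s x - s' x) →
      ∑ x, bornProb σ N x * Real.exp (-q * (s x - s' x)) ≤ lam := by
    intro σ s s' N hb hm
    have := hexp N σ (fun x => -(s x - s' x)) (fun x => by rw [abs_neg]; exact hb x) (by
      simp only [mul_neg, Finset.sum_neg_distrib]
      linarith)
    simpa only [mul_neg, neg_mul] using this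
  refine ⟨m₁ + m₀, M₁, M₀, s₁, s₀, q, lam, hq, hlam, hlam1, ⟨?_, ?_, ?_, ?_⟩, fun σ hσ =>
    ⟨?_, ?_, ?_, ?_⟩⟩
  · simpa [e₁, hs₁] using hf₁.le
  · simp [e₀, hs₁]
  · rintro N (rfl | rfl)
    · simp [e₁, hs₀, sum_bornProb]
    · simpa [e₀, hs₀] using hf₀
  · rintro N (rfl | rfl)
    · refine hdrift hB ?_
      simpa [e₁, hs₁, hs₀] using hκr₁.trans hf₁.le
    · refine hdrift hB ?_
      simpa [e₀, hs₁, hs₀] using hκρ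
  · simpa [e₀, hs₀] using (hf₀D σ hσ).le
  · simp [e₁, hs₀]
  · rintro N (rfl | rfl)
    · simp [e₀, hs₁, sum_bornProb]
    · simpa [e₁, hs₁] using hf₁D σ hσ
  · have hB' : ∀ x, |s₀ x - s₁ x| ≤ 1 + ∑ x, |s₁ x - s₀ x| := fun x => by
      rw [abs_sub_comm]; exact hB x
    rintro N (rfl | rfl)
    · refine hdrift hB' ?_
      simpa [e₀, hs₁, hs₀] using hκr₀.trans (hf₀D σ hσ).le
    · refine hdrift hB' ?_
      simpa [e₁, hs₁, hs₀] using le_neg_of_le_neg (hκD σ hσ)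

/-- The measured relative entropies between `ρ` and a compact convex set of full-rank states that
does not contain `ρ` are bounded away from zero. -/
theorem exists_pos_lt_measuredRelEntropy {ρ : stateSpace d} (hρ : ρ.1.PosDef)
    {D : Set (Matrix (Fin d) (Fin d) ℂ)}
    (hD : D ⊆ fullRankStates d) (hcompact : IsCompact D) (hconvex : Convex ℝ D)
    (hne : D.Nonempty) (hρD : ρ.1 ∉ D) :
    ∃ r : ℝ, 0 < r ∧ ∀ σ : stateSpace d, σ.1 ∈ D →
      ENNReal.ofReal r ≤ measuredRelEntropy σ ρ ∧ ENNReal.ofReal r ≤ measuredRelEntropy ρ σ := by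
  have hneq : ∀ σ : stateSpace d, σ.1 ∈ D → σ ≠ ρ := fun σ hσ h => hρD (h ▸ hσ)
  obtain ⟨m₁, N₁, f₁, hf₁, hf₁D⟩ :=
    exists_evariable_composite_null hρ hD hcompact hconvex hne le_rfl fun σ hσ => by
      rw [ENNReal.ofReal_zero]; exact measuredRelEntropy_pos (hneq σ hσ).symm
  obtain ⟨m₀, N₀, f₀, hf₀, hf₀D⟩ :=
    exists_evariable_composite_alt hρ hD hcompact hconvex hne le_rfl fun σ hσ => by
      rw [ENNReal.ofReal_zero]; exact measuredRelEntropy_pos (hneq σ hσ)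
  obtain ⟨a, ha, hamin⟩ := hcompact.exists_isMinOn hne
    (continuous_outcomeFunctional N₀ f₀).continuousOn
  set τ : stateSpace d := ⟨a, (hD ha).1.posSemidef, (hD ha).2⟩
  refine ⟨min (∑ x, bornProb τ N₀ x * f₀ x) (∑ x, bornProb ρ N₁ x * f₁ x),
    lt_min (hf₀D τ ha) hf₁, fun σ hσ => ⟨?_, ?_⟩⟩
  · refine le_trans (ENNReal.ofReal_le_ofReal ?_) (ofReal_sum_le_measuredRelEntropy σ hρ N₀ hf₀)
    have : outcomeFunctional N₀ f₀ τ.1 ≤ _ := isMinOn_iff.1 hamin σ.1 hσ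
    rw [outcomeFunctional_apply, outcomeFunctional_apply] at this
    exact (min_le_left _ _).trans this
  · exact le_trans (ENNReal.ofReal_le_ofReal (min_le_right _ _))
      (ofReal_sum_le_measuredRelEntropy ρ (hD hσ).1 N₁ (hf₁D σ hσ))

/-! ### Errors and stopping times of tests with drift -/

theorem sum_ofReal_bornProb_mul (ρ : stateSpace d) (M : POVM d m) {w : Fin m → ℝ}
    (hw : ∀ x, 0 ≤ w x) : ∑ x, ENNReal.ofReal (bornProb ρ M x) * ENNReal.ofReal (w x) =
      ENNReal.ofReal (∑ x, bornProb ρ M x * w x) := by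
  rw [ENNReal.ofReal_sum_of_nonneg fun x _ => mul_nonneg (bornProb_nonneg ρ M x) (hw x)]
  exact Finset.sum_congr rfl fun x _ => (ENNReal.ofReal_mul (bornProb_nonneg ρ M x)).symm

theorem prod_ofReal_exp {ι : Type*} (t : Finset ι) (f : ι → ℝ) :
    ∏ i ∈ t, ENNReal.ofReal (Real.exp (f i)) = ENNReal.ofReal (Real.exp (∑ i ∈ t, f i)) := by
  rw [Real.exp_sum, ENNReal.ofReal_prod_of_nonneg fun _ _ => (Real.exp_pos _).le]

section

variable {μ : Strategy d m} {ρ : stateSpace d} {M M' : POVM d m} {s s' : Fin m → ℝ}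
  {q lam r : ℝ}
  (hF : Favours ρ M M' s s' q lam r) (δ : DecisionRule d m)
  (hM : ∀ k, ∀ᵐ ω ∂(μ.law ρ), (ω k).1 = M ∨ (ω k).1 = M')

include hF hM in
-- The product of the exp(s') is a supermartingale from 1 whichever of the two POVMs is used, so
-- Ville's inequality controls its ever reaching e^b.
theorem Favours.law_declares_le {v : Verdict} (hv : v ≠ Verdict.continue) {b : ℝ}
    (hb : ∀ ω k, δ.verdict ω k = v → b ≤ ∑ i ∈ Finset.range (k + 1), s' (ω i).2) :
    μ.law ρ (δ.declares v) ≤ ENNReal.ofReal (Real.exp (-b)) := by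
  have h := mul_measure_exists_le_prod_le_one μ ρ (w := fun x => ENNReal.ofReal (Real.exp (s' x)))
    (fun k => by
      filter_upwards [hM k] with ω hω
      rw [sum_ofReal_bornProb_mul _ _ fun x => (Real.exp_pos _).le, ENNReal.ofReal_le_one]
      exact hF.evariable _ hω) (ENNReal.ofReal (Real.exp b))
  have hsub : δ.declares v ⊆ {ω | ∃ k, ENNReal.ofReal (Real.exp b) ≤
      ∏ i ∈ Finset.range k, ENNReal.ofReal (Real.exp (s' (ω i).2))} := by
    rw [δ.declares_eq_iUnion hv]
    intro ω hω
    obtain ⟨k, -, hk⟩ := Set.mem_iUnion.1 hω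
    refine ⟨k + 1, ?_⟩
    rw [prod_ofReal_exp]
    exact ENNReal.ofReal_le_ofReal (Real.exp_le_exp.2 (hb ω k hk))
  refine (measure_mono hsub).trans ?_
  rw [Real.exp_neg, ENNReal.ofReal_inv_of_pos (Real.exp_pos b)]
  exact ENNReal.le_inv_iff_mul_le.2 (by rwa [mul_comm])

include hF hM in
-- Chernoff's bound: if the sum is nonpositive, the product of the factors exp(−q (s − s')) is at
-- least 1, while its mean is at most `lam ^ k`.
theorem Favours.law_sum_nonpos_le (hq : 0 < q) (hlam : 0 ≤ lam) (k : ℕ) :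
    (μ.law ρ).real {ω | ∑ i ∈ Finset.range k, (s (ω i).2 - s' (ω i).2) ≤ 0} ≤ lam ^ k := by
  have h := lintegral_prod_le_pow μ ρ
    (w := fun x => ENNReal.ofReal (Real.exp (-q * (s x - s' x)))) (c := ENNReal.ofReal lam)
    (fun k => by
      filter_upwards [hM k] with ω hω
      rw [sum_ofReal_bornProb_mul _ _ fun x => (Real.exp_pos _).le]
      exact ENNReal.ofReal_le_ofReal (hF.drift _ hω)) k
  have hmeas : Measurable fun ω : ℕ → Round d m => ∏ i ∈ Finset.range k,
      ENNReal.ofReal (Real.exp (-q * (s (ω i).2 - s' (ω i).2))) := by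
    have hw : Measurable fun x : Fin m => ENNReal.ofReal (Real.exp (-q * (s x - s' x))) :=
      measurable_of_finite _
    exact Finset.measurable_prod _ fun i _ => hw.comp (measurable_pi_apply i).snd
  have h₁ := mul_meas_ge_le_lintegral (μ := μ.law ρ) hmeas 1
  rw [one_mul] at h₁
  refine ENNReal.toReal_le_of_le_ofReal (pow_nonneg hlam k) ?_
  rw [ENNReal.ofReal_pow hlam]
  refine (measure_mono fun ω hω => ?_).trans (h₁.trans h)
  have hω : ∑ i ∈ Finset.range k, (s (ω i).2 - s' (ω i).2) ≤ 0 := hω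
  rw [Set.mem_ofPred_eq, prod_ofReal_exp, ← Finset.mul_sum, ENNReal.one_le_ofReal, Real.one_le_exp_iff]
  nlinarith

include hF hM in
/-- A test that stops as soon as the sum of a statistic with rate `r` exceeds `b` uses about `b / r`
copies. -/
theorem Favours.lintegral_stoppingTime_le (hq : 0 < q) (hlam : 0 ≤ lam) (hlam1 : lam < 1)
    (hr : 0 < r)
    (hM' : ∀ k, ∀ᵐ ω ∂(μ.law ρ), (ω k).1 ≠ M →
      ∑ i ∈ Finset.range k, (s (ω i).2 - s' (ω i).2) ≤ 0)
    {b B : ℝ} (hb0 : 0 ≤ b) (hB : ∀ x, |s x| ≤ B) (hB0 : 0 ≤ B)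
    (hb : ∀ ω k, b ≤ ∑ i ∈ Finset.range (k + 1), s (ω i).2 → δ.verdict ω k ≠ Verdict.continue) :
    ∫⁻ ω, (δ.stoppingTime ω : ℝ≥0∞) ∂(μ.law ρ) ≤
      ENNReal.ofReal ((b + B) / r + 1 / (1 - lam)) := by
  have hs : Measurable fun r : Round d m => s r.2 := (measurable_of_finite s).comp measurable_snd
  have hs' : Measurable fun r : Round d m => s' r.2 :=
    (measurable_of_finite s').comp measurable_snd
  set W : ℕ → Set (ℕ → Round d m) := fun k =>
    {ω | ∑ i ∈ Finset.range k, (s (ω i).2 - s' (ω i).2) ≤ 0}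
  have hW : ∀ k, MeasurableSet (W k) := fun k =>
    measurableSet_le (Finset.measurable_sum _ fun i _ => (hs.comp (measurable_pi_apply i)).sub
      (hs'.comp (measurable_pi_apply i))) measurable_const
  have hint : ∀ k, Integrable (fun ω : ℕ → Round d m => s (ω k).2) (μ.law ρ) := fun k =>
    Integrable.of_bound (hs.comp (measurable_pi_apply k)).aestronglyMeasurable B
      (ae_of_all _ fun ω => hB _)
  -- the stopped sum overshoots by at most one step
  have hub : ∀ N ω, ∑ k ∈ Finset.range N, (δ.running k).indicator (fun ω => s (ω k).2) ω ≤
      b + B := by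
    intro N ω
    induction N with
    | zero => simp; positivity
    | succ N ih =>
      rw [Finset.sum_range_succ]
      by_cases hN : ω ∈ δ.running N
      · have e : ∑ k ∈ Finset.range N, (δ.running k).indicator (fun ω => s (ω k).2) ω =
            ∑ k ∈ Finset.range N, s (ω k).2 :=
          Finset.sum_congr rfl fun k hk => by
            have hk : ω ∈ δ.running k := fun j hj => hN j (hj.trans (Finset.mem_range.1 hk))
            exact Set.indicator_of_mem hk _
        rw [Set.indicator_of_mem hN, e]
        refine add_le_add ?_ ((le_abs_self _).trans (hB _))
        -- Before any outcome the sum is 0 ≤ b; afterwards, not having stopped in the previous round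
        -- means that the sum is still below `b`.
        cases N with
        | zero => simpa using hb0
        | succ N =>
          by_contra! hlt
          exact hb ω N hlt.le (hN N N.lt_succ_self)
      · rw [Set.indicator_of_notMem hN, add_zero]
        exact ih
  -- A round that is reached contributes at least `r` on average if `M` is measured. Otherwise `W k`
  -- holds and the contribution is still nonnegative, so at most `r` is lost.
  have hstep : ∀ k, r * (μ.law ρ).real (δ.running k) - r * (μ.law ρ).real (W k) ≤
      ∫ ω, (δ.running k).indicator (fun ω => s (ω k).2) ω ∂(μ.law ρ) := by
    intro k
    have hR := δ.measurableSet_running' k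
    rw [integral_indicator hR,
      setIntegral_born μ ρ (δ.measurableSet_running_of_le le_rfl) hs (C := B) fun r => hB _]
    calc r * (μ.law ρ).real (δ.running k) - r * (μ.law ρ).real (W k)
        ≤ r * (μ.law ρ).real (δ.running k) - r * (μ.law ρ).real (W k ∩ δ.running k) := by
          gcongr
          · exact measure_ne_top _ _
          · exact Set.inter_subset_left
      _ = ∫ ω in δ.running k, (r - (W k).indicator (fun _ => r) ω) ∂(μ.law ρ) := by
          rw [integral_sub (integrable_const r) ((integrable_const r).indicator (hW k)),
            setIntegral_const, integral_indicator_const _ (hW k),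
            measureReal_restrict_apply (hW k)]
          simp [mul_comm]
      _ ≤ _ := by
          refine integral_mono_ae ((integrable_const r).sub
            ((integrable_const r).indicator (hW k))) ?_ (ae_restrict_of_ae ?_)
          · refine Integrable.of_bound (C := B)
              (Measurable.aestronglyMeasurable (by fun_prop)) (ae_of_all _ fun ω => ?_)
            calc ‖∑ x, bornProb ρ (ω k).1 x * s x‖
                ≤ ∑ x, ‖bornProb ρ (ω k).1 x * s x‖ := norm_sum_le _ _
              _ ≤ ∑ x, bornProb ρ (ω k).1 x * B := by
                  refine Finset.sum_le_sum fun x _ => ?_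
                  rw [norm_mul, Real.norm_of_nonneg (bornProb_nonneg _ _ _)]
                  exact mul_le_mul_of_nonneg_left (hB _) (bornProb_nonneg _ _ _)
              _ = B := by rw [← Finset.sum_mul, sum_bornProb, one_mul]
          · filter_upwards [hM k, hM' k] with ω h₁ h₂
            by_cases hω : (ω k).1 = M
            · simp only [hω]
              refine le_trans ?_ hF.rate_le
              have : 0 ≤ (W k).indicator (fun _ => r) ω := Set.indicator_nonneg (fun _ _ => hr.le) ω
              linarith
            · simp only [h₁.resolve_left hω]
              have : ω ∈ W k := h₂ hω
              rw [Set.indicator_of_mem this, sub_self]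
              exact hF.nonneg
  have hN : ∀ N, ∑ k ∈ Finset.range N, (μ.law ρ).real (δ.running k) ≤
      (b + B) / r + 1 / (1 - lam) := by
    intro N
    have h₁ : ∫ ω, ∑ k ∈ Finset.range N, (δ.running k).indicator (fun ω => s (ω k).2) ω
        ∂(μ.law ρ) ≤ b + B := by
      refine (integral_mono (integrable_finsetSum _ fun k _ =>
        (hint k).indicator (δ.measurableSet_running' k)) (integrable_const (b + B))
          (hub N)).trans_eq ?_
      simp
    rw [integral_finsetSum _ fun k _ => (hint k).indicator (δ.measurableSet_running' k)] at h₁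
    have h₂ := (Finset.sum_le_sum fun k (_ : k ∈ Finset.range N) => hstep k).trans h₁
    rw [Finset.sum_sub_distrib, ← Finset.mul_sum, ← Finset.mul_sum] at h₂
    -- The expected number of rounds with the wrong measurement is bounded by a geometric series
    -- that does not depend on the threshold.
    have h₃ : ∑ k ∈ Finset.range N, (μ.law ρ).real (W k) ≤ 1 / (1 - lam) := by
      refine (Finset.sum_le_sum fun k _ => hF.law_sum_nonpos_le hM hq hlam k).trans ?_
      rw [one_div, ← tsum_geometric_of_lt_one hlam hlam1]
      exact (summable_geometric_of_lt_one hlam hlam1).sum_le_tsum _ fun k _ => pow_nonneg hlam k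
    rw [div_add' _ _ _ hr.ne', le_div_iff₀ hr]
    nlinarith
  rw [δ.lintegral_stoppingTime, ENNReal.tsum_eq_iSup_nat]
  refine iSup_le fun N => ?_
  have hm : ∀ k, μ.law ρ (δ.running k) = ENNReal.ofReal ((μ.law ρ).real (δ.running k)) := fun k =>
    (ofReal_measureReal (measure_ne_top _ _)).symm
  rw [Finset.sum_congr rfl fun k _ => hm k,
    ← ENNReal.ofReal_sum_of_nonneg fun _ _ => measureReal_nonneg]
  exact ENNReal.ofReal_le_ofReal (hN N)

end

/-! ### The adaptive strategy -/

/-- Together with second countability this makes the coincidence of two measurable choices of POVM a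
measurable event, as needed in `signStrategy_ae`. -/
instance : T2Space (POVM d m) := inferInstanceAs (T2Space {M : Fin m → Matrix (Fin d) (Fin d) ℂ //
  (∀ x, (M x).PosSemidef) ∧ ∑ x, M x = 1})

instance : SecondCountableTopology (POVM d m) :=
  inferInstanceAs (SecondCountableTopology {M : Fin m → Fin d → Fin d → ℂ //
    (∀ x, (Matrix.of (M x)).PosSemidef) ∧ ∑ x, Matrix.of (M x) = 1})

open Classical in
/-- Choose `M₁` if the sum of the statistic `g` is nonnegative so far, and `M₀` otherwise. -/
noncomputable def signChoice (M₁ M₀ : POVM d m) (g : Fin m → ℝ) (k : ℕ) (p : Fin k → Round d m) :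
    POVM d m :=
  if 0 ≤ ∑ i, g (p i).2 then M₁ else M₀

theorem measurable_signChoice (M₁ M₀ : POVM d m) (g : Fin m → ℝ) (k : ℕ) :
    Measurable (signChoice M₁ M₀ g k) := by
  have hg : Measurable fun r : Round d m => g r.2 := (measurable_of_finite g).comp measurable_snd
  exact Measurable.ite (measurableSet_le measurable_const
    (Finset.measurable_sum _ fun i _ => hg.comp (measurable_pi_apply i)))
    measurable_const measurable_const

/-- The strategy that measures `M₁` while the sum of `g` is nonnegative, and `M₀` otherwise. -/
noncomputable def signStrategy (M₁ M₀ : POVM d m) (g : Fin m → ℝ) : Strategy d m where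
  first := Measure.dirac M₁
  next k := Kernel.deterministic (fun h => signChoice M₁ M₀ g (k + 1) (ofHistory k h))
    ((measurable_signChoice M₁ M₀ g (k + 1)).comp (measurable_ofHistory k))
  isProbabilityMeasure_first := inferInstance
  isMarkovKernel_next _ := inferInstance

theorem signStrategy_choice (M₁ M₀ : POVM d m) (g : Fin m → ℝ) (k : ℕ) (p : Fin k → Round d m) :
    (signStrategy M₁ M₀ g).choice k p = Measure.dirac (signChoice M₁ M₀ g k p) := by
  cases k with
  | zero => simp [Strategy.choice, signStrategy, signChoice]
  | succ k =>
    simp only [Strategy.choice, signStrategy, Kernel.comap_apply, Kernel.deterministic_apply]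
    rfl

/-- The choice kernels are Dirac measures, so by disintegration the event of a deviating POVM is
null. -/
theorem signStrategy_ae (M₁ M₀ : POVM d m) (g : Fin m → ℝ) (ρ : stateSpace d) (k : ℕ) :
    ∀ᵐ ω ∂((signStrategy M₁ M₀ g).law ρ), (ω k).1 =
      if 0 ≤ ∑ i ∈ Finset.range k, g (ω i).2 then M₁ else M₀ := by
  classical
  have hS : MeasurableSet {q : (Fin k → Round d m) × Round d m |
      q.2.1 ≠ signChoice M₁ M₀ g k q.1} :=
    (measurableSet_eq_fun measurable_snd.fst
      ((measurable_signChoice M₁ M₀ g k).comp measurable_fst)).compl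
  have h := lintegral_law (signStrategy M₁ M₀ g) ρ k
    (fun p r => {q : (Fin k → Round d m) × Round d m |
      q.2.1 ≠ signChoice M₁ M₀ g k q.1}.indicator 1 (p, r)) (measurable_one.indicator hS)
  have hz : ∀ ω : ℕ → Round d m, ∫⁻ M, ∑ x, ENNReal.ofReal (bornProb ρ M x) *
      {q : (Fin k → Round d m) × Round d m |
        q.2.1 ≠ signChoice M₁ M₀ g k q.1}.indicator 1 (past k ω, (M, x))
          ∂((signStrategy M₁ M₀ g).choice k (past k ω)) = 0 := by
    intro ω
    rw [signStrategy_choice, lintegral_dirac]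
    simp
  simp only [hz, lintegral_zero] at h
  have hm : Measurable fun ω : ℕ → Round d m => (past k ω, ω k) := by fun_prop
  filter_upwards [(lintegral_eq_zero_iff ((measurable_one.indicator hS).comp hm)).1 h] with ω hω
  have : (ω k).1 = signChoice M₁ M₀ g k (past k ω) := by
    by_contra hne
    have : (past k ω, ω k) ∈ {q : (Fin k → Round d m) × Round d m |
      q.2.1 ≠ signChoice M₁ M₀ g k q.1} := hne
    simp [Set.indicator_of_mem this] at hω
  rw [this, signChoice, Finset.sum_range]
  rfl

open Classical in
/-- Declare the null hypothesis when the sum of `s₁` reaches `b₁`, and the alternative when the sum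
of `s₀` reaches `b₀`. -/
noncomputable def thresholdRule (d : ℕ) (s₁ s₀ : Fin m → ℝ) (b₁ b₀ : ℝ) : DecisionRule d m where
  decide k h :=
    if b₁ ≤ ∑ i, s₁ (h i).2 then Verdict.null
    else if b₀ ≤ ∑ i, s₀ (h i).2 then Verdict.alt else Verdict.continue
  measurableSet_decide k v := by
    have hs : ∀ s : Fin m → ℝ, Measurable fun h : History d m k => ∑ i, s (h i).2 := fun s =>
      Finset.measurable_sum _ fun i _ => (measurable_of_finite s).comp (measurable_pi_apply i).snd
    let _ : MeasurableSpace Verdict := ⊤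
    exact (Measurable.ite (measurableSet_le measurable_const (hs s₁)) measurable_const
      (Measurable.ite (measurableSet_le measurable_const (hs s₀)) measurable_const
        measurable_const)) (MeasurableSpace.measurableSet_top (s := {v}))

open Classical in
theorem thresholdRule_verdict (s₁ s₀ : Fin m → ℝ) (b₁ b₀ : ℝ) (ω : ℕ → Round d m) (k : ℕ) :
    (thresholdRule d s₁ s₀ b₁ b₀).verdict ω k =
      if b₁ ≤ ∑ i ∈ Finset.range (k + 1), s₁ (ω i).2 then Verdict.null
      else if b₀ ≤ ∑ i ∈ Finset.range (k + 1), s₀ (ω i).2 then Verdict.alt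
      else Verdict.continue := by
  have h : ∀ s : Fin m → ℝ, ∑ i : Finset.Iic k, s (ω i).2 =
      ∑ i ∈ Finset.range (k + 1), s (ω i).2 := fun s => by
    rw [Finset.sum_coe_sort (Finset.Iic k) fun i => s (ω i).2]
    congr 1
    ext i
    simp
  simp only [DecisionRule.verdict, thresholdRule, h]

/-! ### Achievability -/

theorem coe_ennreal_sub_nonpos {x : ℝ≥0∞} {n : ℕ} (h : x ≤ n) :
    (x : EReal) - ((n : ℝ) : EReal) ≤ 0 := by
  rw [EReal.sub_nonpos]
  calc (x : EReal) ≤ ((n : ℝ≥0∞) : EReal) := EReal.coe_ennreal_le_coe_ennreal_iff.2 h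
    _ = _ := by
      rw [← ENNReal.ofReal_natCast, EReal.coe_ennreal_ofReal, max_eq_left n.cast_nonneg]

theorem le_liminf_rate {e : ℕ → ℝ≥0∞} {R : ℝ}
    (h : ∀ n : ℕ, e n ≤ ENNReal.ofReal (Real.exp (-(n * R)))) :
    (R : EReal) ≤ liminf (fun n : ℕ => ((1 / n : ℝ) : EReal) * ENNReal.log (e n)⁻¹) atTop := by
  refine le_liminf_of_le (by isBoundedDefault) ?_
  filter_upwards [eventually_ne_atTop 0] with n hn
  exact (coe_le_rate_iff hn R (e n)).2 (h n)

theorem tendsto_zero_of_le_exp {e : ℕ → ℝ≥0∞} {R : ℝ} (hR : 0 < R)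
    (h : ∀ n : ℕ, e n ≤ ENNReal.ofReal (Real.exp (-(n * R)))) : Tendsto e atTop (𝓝 0) := by
  refine tendsto_of_tendsto_of_tendsto_of_le_of_le tendsto_const_nhds ?_ (fun _ => zero_le) h
  rw [← ENNReal.ofReal_zero]
  refine ENNReal.tendsto_ofReal (Real.tendsto_exp_neg_atTop_nhds_zero.comp ?_)
  exact tendsto_natCast_atTop_atTop.atTop_mul_const hR

/-- The gap between the thresholds' rates `R₀`, `R₁` and the growth rates `r₀`, `r₁` absorbs the
constants in the expected time. Only the thresholds depend on `n`, so one strategy serves all `n`.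
-/
theorem exists_achieves {ρ : stateSpace d} (hρ : ρ.1.PosDef) {D : Set (Matrix (Fin d) (Fin d) ℂ)}
    (hD : D ⊆ fullRankStates d) (hcompact : IsCompact D) (hconvex : Convex ℝ D)
    (hne : D.Nonempty) {R₀ R₁ r₀ r₁ : ℝ} (hR₀ : 0 < R₀) (hR₁ : 0 < R₁) (hr₀ : R₀ < r₀)
    (hr₁ : R₁ < r₁)
    (h₀ : ∀ σ : stateSpace d, σ.1 ∈ D → ENNReal.ofReal r₀ < measuredRelEntropy σ ρ)
    (h₁ : ∀ σ : stateSpace d, σ.1 ∈ D → ENNReal.ofReal r₁ < measuredRelEntropy ρ σ) :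
    ∃ (m : ℕ) (μ : Strategy d m) (δ : ℕ → DecisionRule d m),
      Achieves ρ D (fun n => ⟨m, μ, δ n⟩) (R₀, R₁) := by
  have hr₀0 := hR₀.trans hr₀
  have hr₁0 := hR₁.trans hr₁
  obtain ⟨m, M₁, M₀, s₁, s₀, q, lam, hq, hlam, hlam1, hFρ, hFD⟩ :=
    exists_favours hρ hD hcompact hconvex hne hr₀0 hr₁0 h₀ h₁
  set μ := signStrategy M₁ M₀ (fun x => s₁ x - s₀ x)
  set δ : ℕ → DecisionRule d m := fun n => thresholdRule d s₁ s₀ (n * R₁) (n * R₀) with hδ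
  have hae : ∀ (τ : stateSpace d) (k : ℕ), ∀ᵐ ω ∂(μ.law τ), (ω k).1 =
      if 0 ≤ ∑ i ∈ Finset.range k, (s₁ (ω i).2 - s₀ (ω i).2) then M₁ else M₀ := fun τ k =>
    signStrategy_ae M₁ M₀ _ τ k
  have hM : ∀ (τ : stateSpace d) (k : ℕ), ∀ᵐ ω ∂(μ.law τ), (ω k).1 = M₁ ∨ (ω k).1 = M₀ := by
    intro τ k
    filter_upwards [hae τ k] with ω hω
    rw [hω]; split_ifs <;> simp
  have hM' : ∀ (τ : stateSpace d) (k : ℕ), ∀ᵐ ω ∂(μ.law τ), (ω k).1 = M₀ ∨ (ω k).1 = M₁ :=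
    fun τ k => (hM τ k).mono fun ω => Or.symm
  have hnull : ∀ n ω k, (δ n).verdict ω k = Verdict.null →
      n * R₁ ≤ ∑ i ∈ Finset.range (k + 1), s₁ (ω i).2 := by
    intro n ω k h
    rw [hδ, thresholdRule_verdict] at h
    split_ifs at h with h₁ h₂
    exact h₁
  have halt : ∀ n ω k, (δ n).verdict ω k = Verdict.alt →
      n * R₀ ≤ ∑ i ∈ Finset.range (k + 1), s₀ (ω i).2 := by
    intro n ω k h
    rw [hδ, thresholdRule_verdict] at h
    split_ifs at h with h₁ h₂
    exact h₂
  have hstop₁ : ∀ (n : ℕ) ω k, n * R₁ ≤ ∑ i ∈ Finset.range (k + 1), s₁ (ω i).2 →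
      (δ n).verdict ω k ≠ Verdict.continue := by
    intro n ω k h
    rw [hδ, thresholdRule_verdict, if_pos h]
    simp
  have hstop₀ : ∀ (n : ℕ) ω k, n * R₀ ≤ ∑ i ∈ Finset.range (k + 1), s₀ (ω i).2 →
      (δ n).verdict ω k ≠ Verdict.continue := by
    intro n ω k h
    rw [hδ, thresholdRule_verdict]
    split_ifs <;> simp
  have hα : ∀ n : ℕ, Test.typeIError ⟨m, μ, δ n⟩ ρ ≤ ENNReal.ofReal (Real.exp (-(n * R₀))) :=
    fun n => hFρ.law_declares_le (δ n) (hM ρ) (by simp) (halt n)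
  have hβ : ∀ n : ℕ, Test.typeIIError ⟨m, μ, δ n⟩ D ≤ ENNReal.ofReal (Real.exp (-(n * R₁))) :=
    fun n => iSup₂_le fun σ hσ => (hFD σ hσ).law_declares_le (δ n) (hM' σ) (by simp) (hnull n)
  set B := ∑ x, |s₁ x| + ∑ x, |s₀ x| with hB
  have hB0 : 0 ≤ B := by positivity
  have hB₁ : ∀ x, |s₁ x| ≤ B := fun x =>
    (Finset.single_le_sum (f := fun x => |s₁ x|) (fun _ _ => abs_nonneg _)
      (Finset.mem_univ x)).trans (le_add_of_nonneg_right (by positivity))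
  have hB₀ : ∀ x, |s₀ x| ≤ B := fun x =>
    (Finset.single_le_sum (f := fun x => |s₀ x|) (fun _ _ => abs_nonneg _)
      (Finset.mem_univ x)).trans (le_add_of_nonneg_left (by positivity))
  have hTρ : ∀ n : ℕ, Test.expectedTime ⟨m, μ, δ n⟩ ρ ≤
      ENNReal.ofReal ((n * R₁ + B) / r₁ + 1 / (1 - lam)) := fun n =>
    hFρ.lintegral_stoppingTime_le (δ n) (hM ρ) hq hlam hlam1 hr₁0 (fun k => by
      filter_upwards [hae ρ k] with ω hω hne
      rw [hω] at hne
      split_ifs at hne with h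
      · exact absurd rfl hne
      · exact (not_le.1 h).le) (by positivity) hB₁ hB0 (hstop₁ n)
  have hTD : ∀ (n : ℕ) (σ : stateSpace d), σ.1 ∈ D → Test.expectedTime ⟨m, μ, δ n⟩ σ ≤
      ENNReal.ofReal ((n * R₀ + B) / r₀ + 1 / (1 - lam)) := fun n σ hσ =>
    (hFD σ hσ).lintegral_stoppingTime_le (δ n) (hM' σ) hq hlam hlam1 hr₀0 (fun k => by
      filter_upwards [hae σ k] with ω hω hne
      rw [hω] at hne
      split_ifs at hne with h
      · rw [← neg_nonneg, ← Finset.sum_neg_distrib]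
        simpa only [neg_sub] using h
      · exact absurd rfl hne) (by positivity) hB₀ hB0 (hstop₀ n)
  -- The slack n (1 − R/r) outgrows the overshoot and the cost of the wrong measurements.
  have hev : ∀ {R r : ℝ}, R < r → 0 < r →
      ∀ᶠ n : ℕ in atTop, (n * R + B) / r + 1 / (1 - lam) ≤ (n : ℝ) := by
    intro R r hRr hr
    have h : Tendsto (fun n : ℕ => (n : ℝ) * ((r - R) / r)) atTop atTop :=
      tendsto_natCast_atTop_atTop.atTop_mul_const (div_pos (sub_pos.2 hRr) hr)
    filter_upwards [h.eventually_ge_atTop (B / r + 1 / (1 - lam))] with n hn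
    have e : (n : ℝ) = n * ((r - R) / r) + n * R / r := by field_simp; ring
    rw [add_div]
    linarith
  refine ⟨m, μ, δ, tendsto_zero_of_le_exp hR₀ hα, tendsto_zero_of_le_exp hR₁ hβ,
    le_liminf_rate hα, le_liminf_rate hβ, limsup_le_of_le (by isBoundedDefault) ?_⟩
  filter_upwards [hev hr₁ hr₁0, hev hr₀ hr₀0] with n hn₁ hn₀
  refine coe_ennreal_sub_nonpos (max_le ?_ (iSup₂_le fun σ hσ => ?_))
  · exact (hTρ n).trans ((ENNReal.ofReal_le_ofReal hn₁).trans_eq (ENNReal.ofReal_natCast n))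
  · exact (hTD n σ hσ).trans ((ENNReal.ofReal_le_ofReal hn₀).trans_eq (ENNReal.ofReal_natCast n))

/-! ### From the open rectangle to its closure -/

/-- Strictly below the extended bound `c`, with room for a rate in between. -/
theorem exists_between_of_lt_iInf {f : stateSpace d → ℝ≥0∞} {D : Set (Matrix (Fin d) (Fin d) ℂ)}
    {R : ℝ} (h : ENNReal.ofReal R < ⨅ (σ : stateSpace d) (_ : σ.1 ∈ D), f σ) :
    ∃ r : ℝ, R < r ∧ ∀ σ : stateSpace d, σ.1 ∈ D → ENNReal.ofReal r < f σ := by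
  obtain ⟨x, hx, hxf⟩ := exists_between h
  have hxt : x ≠ ∞ := hxf.ne_top
  refine ⟨x.toReal, ?_, fun σ hσ => ?_⟩
  · rcases le_or_gt 0 R with hR | hR
    · exact (ENNReal.ofReal_lt_iff_lt_toReal hR hxt).1 hx
    · exact hR.trans_le ENNReal.toReal_nonneg
  · rw [ENNReal.ofReal_toReal hxt]
    exact hxf.trans_le (iInf₂_le σ hσ)

/-- A positive `x` is either itself in the set or is approached from below, and 0 is approached from
above, which is possible because c ≠ 0. This is why the divergences must be bounded away from zero
on `D`. -/
theorem mem_closure_Ioo_of_le {c : ℝ≥0∞} (hc : c ≠ 0) {x : ℝ} (hx : 0 ≤ x)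
    (hxc : ENNReal.ofReal x ≤ c) : x ∈ closure {y : ℝ | 0 < y ∧ ENNReal.ofReal y < c} := by
  obtain ⟨a, ha0, hac⟩ : ∃ a : ℝ, 0 < a ∧ ENNReal.ofReal a < c := by
    obtain ⟨a, ha0, hac⟩ := exists_between (pos_iff_ne_zero.2 hc)
    have hat : a ≠ ∞ := hac.ne_top
    exact ⟨a.toReal, ENNReal.toReal_pos ha0.ne' hat, by rwa [ENNReal.ofReal_toReal hat]⟩
  rcases le_or_gt x a with h | h
  · rcases hx.eq_or_lt with rfl | hx0
    · have hsub : Set.Ioo 0 a ⊆ {y : ℝ | 0 < y ∧ ENNReal.ofReal y < c} := fun y hy => ⟨hy.1,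
        (ENNReal.ofReal_le_ofReal hy.2.le).trans_lt hac⟩
      refine closure_mono hsub ?_
      rw [closure_Ioo ha0.ne]
      exact ⟨le_rfl, ha0.le⟩
    · exact subset_closure ⟨hx0, (ENNReal.ofReal_le_ofReal h).trans_lt hac⟩
  · have hsub : Set.Ioo a x ⊆ {y : ℝ | 0 < y ∧ ENNReal.ofReal y < c} := fun y hy => ⟨ha0.trans hy.1,
      ((ENNReal.ofReal_lt_ofReal_iff (ha0.trans h)).2 hy.2).trans_le hxc⟩
    refine closure_mono hsub ?_
    rw [closure_Ioo h.ne]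
    exact ⟨h.le, le_rfl⟩

theorem entropyRectangle_subset_commonStrategyRegion {ρ : stateSpace d} (hρ : ρ.1.PosDef)
    {D : Set (Matrix (Fin d) (Fin d) ℂ)} (hD : D ⊆ fullRankStates d) (hcompact : IsCompact D)
    (hconvex : Convex ℝ D) (hne : D.Nonempty) (hρD : ρ.1 ∉ D) :
    entropyRectangle ρ D ⊆ commonStrategyRegion ρ D := by
  obtain ⟨r, hr, hrD⟩ := exists_pos_lt_measuredRelEntropy hρ hD hcompact hconvex hne hρD
  have hr' : 0 < ENNReal.ofReal r := ENNReal.ofReal_pos.2 hr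
  have hc₀ : (⨅ (σ : stateSpace d) (_ : σ.1 ∈ D), measuredRelEntropy σ ρ) ≠ 0 :=
    (hr'.trans_le (le_iInf₂ fun σ hσ => (hrD σ hσ).1)).ne'
  have hc₁ : (⨅ (σ : stateSpace d) (_ : σ.1 ∈ D), measuredRelEntropy ρ σ) ≠ 0 :=
    (hr'.trans_le (le_iInf₂ fun σ hσ => (hrD σ hσ).2)).ne'
  rintro ⟨R₀, R₁⟩ ⟨h₀, h₁, hR₀, hR₁⟩
  rw [coe_le_coe_ennreal_iff] at hR₀ hR₁
  have hmem : (R₀, R₁) ∈ closure ({y : ℝ | 0 < y ∧ ENNReal.ofReal y <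
      ⨅ (σ : stateSpace d) (_ : σ.1 ∈ D), measuredRelEntropy σ ρ} ×ˢ {y : ℝ | 0 < y ∧
        ENNReal.ofReal y < ⨅ (σ : stateSpace d) (_ : σ.1 ∈ D), measuredRelEntropy ρ σ}) := by
    rw [closure_prod_eq]
    exact ⟨mem_closure_Ioo_of_le hc₀ h₀ hR₀, mem_closure_Ioo_of_le hc₁ h₁ hR₁⟩
  refine closure_mono ?_ hmem
  rintro ⟨x, y⟩ ⟨⟨hx0, hx⟩, hy0, hy⟩
  obtain ⟨r₀, hr₀, hr₀D⟩ := exists_between_of_lt_iInf hx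
  obtain ⟨r₁, hr₁, hr₁D⟩ := exists_between_of_lt_iInf hy
  exact ⟨hx0.le, hy0.le,
    exists_achieves hρ hD hcompact hconvex hne hx0 hy0 hr₀ hr₁ hr₀D hr₁D⟩

theorem commonStrategyRegion_subset_errorExponentRegion (ρ : stateSpace d)
    (D : Set (Matrix (Fin d) (Fin d) ℂ)) :
    commonStrategyRegion ρ D ⊆ errorExponentRegion ρ D := by
  refine closure_mono ?_
  rintro R ⟨h₀, h₁, m, μ, δ, h⟩
  exact ⟨h₀, h₁, _, h⟩

theorem errorExponentRegion_subset_entropyRectangle {ρ : stateSpace d}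
    (hρ : ρ.1 ∈ fullRankStates d) {D : Set (Matrix (Fin d) (Fin d) ℂ)}
    (hD : D ⊆ fullRankStates d) : errorExponentRegion ρ D ⊆ entropyRectangle ρ D := by
  refine closure_minimal ?_ (isClosed_entropyRectangle ρ D)
  rintro R ⟨h₀, h₁, S, h⟩
  exact h.mem_entropyRectangle hρ hD h₀ h₁

end SQHT

theorem mainTheorem1 {d : ℕ} (ρ : SQHT.stateSpace d) (hρ : ρ.1 ∈ SQHT.fullRankStates d)
    (D : Set (Matrix (Fin d) (Fin d) ℂ)) (hD : D ⊆ SQHT.fullRankStates d)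
    (hcompact : IsCompact D) (hconvex : Convex ℝ D)
    (hinterior : (interior {a : SQHT.traceOneHermitian d | a.1 ∈ D}).Nonempty)
    (hρD : ρ.1 ∉ D) :
    SQHT.errorExponentRegion ρ D = SQHT.entropyRectangle ρ D ∧
      SQHT.commonStrategyRegion ρ D = SQHT.entropyRectangle ρ D := by
  have hne : D.Nonempty := by
    obtain ⟨a, ha⟩ := hinterior
    have haD : a ∈ {a : SQHT.traceOneHermitian d | a.1 ∈ D} := interior_subset ha
    exact ⟨a.1, haD⟩
  have h₁ := SQHT.entropyRectangle_subset_commonStrategyRegion hρ.1 hD hcompact hconvex hne hρD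
  have h₂ := SQHT.commonStrategyRegion_subset_errorExponentRegion ρ D
  have h₃ := SQHT.errorExponentRegion_subset_entropyRectangle hρ hD
  exact ⟨h₃.antisymm (h₁.trans h₂), (h₂.trans h₃).antisymm h₁⟩
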